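/- Let $\mathbb T_1$ be the single vertex with label $1$ (the root) and, for $n\ge 2$, let $\mathbb T_n$ be obtained from $\mathbb T_{n-1}$ by attaching the vertex with label $n$ to an independent, uniformly chosen vertex of $\mathbb T_{n-1}$. For $\alpha\in(0,1]$ let the numbers of cars arriving at the vertices $1,2,\dots$ be i.i.d., independent of the trees, with law $$\mu_\alpha^{\rm Binary}=\Big(1-\frac\alpha2\Big)\delta_0+\frac\alpha2\,\delta_2 .$$ Each car arriving at a vertex of $\mathbb T_n$ parks at the first free vertex that it meets when it drives from its arrival vertex (included) towards the root; if there is none, it exits the tree. Let $\varphi(\mathbb T_n,\mu_\alpha^{\rm Binary})$ be the total number of cars exiting $\mathbb T_n$ (it does not depend on the order in which the cars drive), with $\varphi(\mathbb T_0,\cdot)=0$, and for real $C>0$ let $$\theta(\mu_\alpha^{\rm Binary},C)=\inf\{n\ge 0:\varphi(\mathbb T_n,\mu_\alpha^{\rm Binary})\ge C\}\in\{1,2,\dots\}\cup\{\infty\}.$$ Then, for every $C>0$, $$\frac{\log\log\theta(\mu_\alpha^{\rm Binary},C)}{|\log\alpha|}\longrightarrow\frac12\quad\text{in probability as }\alpha\downarrow0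 ,$$ where $\log\log 1=-\infty$ and $\log\log\infty=+\infty$; that is, for every $\varepsilon>0$ the probability that the ratio lies in $(\frac12-\varepsilon,\frac12+\varepsilon)$ tends to $1$. -/

import Mathlib

open MeasureTheory ProbabilityTheory Filter Topology

/-- An increasing sequence of recursive trees, coded by its attachment choices. Vertices are indexed
by `ℕ`, index `k` standing for the vertex with label `k + 1`; index `0` is the root, and the parent
of index `k + 1` is `u k`, one of the older indices `0, …, k`. The tree `𝕋ₙ` is the subtree on the
indices `0, …, n - 1`. -/
abbrev AttachSeq : Type := (k : ℕ) → Fin (k + 1)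

/-- The vertex at which a car parks if it starts driving from the given vertex towards the root
while the vertices of `occ` are occupied: the first free vertex on the way to the root, or `none`
if there is no free vertex on that way, in which case the car exits through the root. -/
def parkingSpot (u : AttachSeq) (occ : Finset ℕ) : ℕ → Option ℕ
  | 0 => if 0 ∈ occ then none else some 0
  | k + 1 => if k + 1 ∈ occ then parkingSpot u occ (u k) else some (k + 1)
termination_by v => v
decreasing_by exact (u k).isLt

/-- One car arrives at `v`. A state `(occ, e)` consists of the set `occ` of occupied vertices and
the number `e` of cars that have exited the tree so far. -/
def parkCar (u : AttachSeq) (v : ℕ) (s : Finset ℕ × ℕ) : Finset ℕ × ℕ :=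
  match parkingSpot u s.1 v with
  | none => (s.1, s.2 + 1)
  | some w => (insert w s.1, s.2)

/-- How a newly occupied vertex `x` changes the parking spots. -/
theorem parkingSpot_insert (u : AttachSeq) (occ : Finset ℕ) (x : ℕ) (v : ℕ) :
    parkingSpot u (insert x occ) v =
      if parkingSpot u occ v = some x then parkingSpot u (insert x occ) x
      else parkingSpot u occ v := by
  induction v using Nat.strong_induction_on with
  | _ v ih =>
    cases v with
    | zero =>
      by_cases h0 : 0 ∈ occ
      · simp [parkingSpot, h0]
      · by_cases hx : x = 0
        · subst hx; simp [parkingSpot, h0]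
        · have : ¬ (0 = x) := fun h => hx h.symm
          simp [parkingSpot, h0, this]
    | succ k =>
      by_cases h0 : k + 1 ∈ occ
      · have h1 : parkingSpot u occ (k + 1) = parkingSpot u occ (u k) := by
          rw [parkingSpot, if_pos h0]
        have h2 : parkingSpot u (insert x occ) (k + 1) = parkingSpot u (insert x occ) (u k) := by
          rw [parkingSpot, if_pos (Finset.mem_insert_of_mem h0)]
        rw [h1, h2]
        exact ih _ (u k).isLt
      · have h1 : parkingSpot u occ (k + 1) = some (k + 1) := by
          rw [parkingSpot, if_neg h0]
        rw [h1]
        by_cases hx : k + 1 = x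
        · subst hx; simp
        · rw [if_neg (by simpa using hx), parkingSpot, if_neg (by simp [h0, hx])]

/-- The order in which cars arrive is irrelevant for the final state. -/
instance parkCar_leftCommutative (u : AttachSeq) : LeftCommutative (parkCar u) where
  left_comm v w s := by
    obtain ⟨occ, e⟩ := s
    unfold parkCar
    rcases hv : parkingSpot u occ v with _ | x <;> rcases hw : parkingSpot u occ w with _ | y
    · simp [hv]
    · simp [hv, parkingSpot_insert u occ y v]
    · simp [hv, hw, parkingSpot_insert u occ x w]
    · by_cases hxy : x = y
      · subst hxy
        simp [hv, hw, parkingSpot_insert u occ x v, parkingSpot_insert u occ x w]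
      · have hyx : ¬ y = x := fun h => hxy h.symm
        simp [hv, hw, parkingSpot_insert u occ x w, parkingSpot_insert u occ y v, hxy, hyx,
          Finset.insert_comm x y]

/-- All the cars arriving on `𝕋ₙ`, each recorded by its arrival vertex: `a k` cars arrive at `k`. -/
def arrivingCars (a : ℕ → ℕ) (n : ℕ) : Multiset ℕ :=
  ∑ k ∈ Finset.range n, Multiset.replicate (a k) k

/-- The flux: the number of cars exiting `𝕋ₙ` once all the cars arriving on `𝕋ₙ` have driven,
starting from the empty parking lot. -/
def flux (u : AttachSeq) (a : ℕ → ℕ) (n : ℕ) : ℕ :=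
  ((arrivingCars a n).foldr (parkCar u) (∅, 0)).2

/-- The time of appearance of a flux of at least `C`, equal to `⊤` if there is no such time. -/
noncomputable def appearanceTime (u : AttachSeq) (a : ℕ → ℕ) (C : ℝ) : ℕ∞ :=
  sInf ((fun n : ℕ => (n : ℕ∞)) '' {n : ℕ | C ≤ (flux u a n : ℝ)})

/-- `log log θ` with values in the extended reals: it is `⊥` at `θ = 1` and `⊤` at `θ = ⊤`. -/
noncomputable def logLog (θ : ℕ∞) : EReal :=
  ENNReal.log (ENNReal.log (θ : ENNReal)).toENNReal

/-- The binary arrival law `(1 - α / 2) δ₀ + (α / 2) δ₂`. -/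
noncomputable def binaryLaw (α : ℝ) : Measure ℕ :=
  ENNReal.ofReal (1 - α / 2) • Measure.dirac 0 + ENNReal.ofReal (α / 2) • Measure.dirac 2

/-- The random variables `U` and `A` are the attachment choices of the increasing sequence of
uniform random recursive trees, and car arrivals that are i.i.d. of law `μ` on the vertices,
independent of the trees. -/
structure IsParkingOnRRT {Ω : Type*} [MeasurableSpace Ω] (P : Measure Ω)
    (U : (k : ℕ) → Ω → Fin (k + 1)) (A : ℕ → Ω → ℕ) (μ : Measure ℕ) : Prop where
  measurable_attach : ∀ k, Measurable (U k)
  measurable_arrival : ∀ k, Measurable (A k)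
  map_attach : ∀ k, P.map (U k) = (PMF.uniformOfFintype (Fin (k + 1))).toMeasure
  map_arrival : ∀ k, P.map (A k) = μ
  iIndepFun_attach : iIndepFun U P
  iIndepFun_arrival : iIndepFun A P
  indepFun : IndepFun (fun ω k => U k ω) (fun ω k => A k ω) P

/-- Convergence in probability to the real constant `c`, along the filter `l`, of a family of
random variables with values in the extended reals, each on its own probability space. -/
def TendstoInProbability {ι : Type*} {Ω : ι → Type*} [∀ i, MeasurableSpace (Ω i)]
    (P : ∀ i, Measure (Ω i)) (X : ∀ i, Ω i → EReal) (l : Filter ι) (c : ℝ) : Prop :=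
  ∀ ε : ℝ, 0 < ε →
    Tendsto (fun i => P i {ω | ¬ (((c - ε : ℝ) : EReal) < X i ω ∧ X i ω < ((c + ε : ℝ) : EReal))})
      l (𝓝 0)

/-!
The time scale `log θ = α ^ (-1/2)` is where overfull subtrees at the root start to exist.

*Lower bound on `θ`.* A positive flux forces a subtree containing the root on which more cars arrive
than it has vertices (`exists_overfull_subtree`). The expected number of subtrees of `𝕋ₙ` with
`m + 1` vertices that contain the root is at most `Hₙ ^ m`, where `Hₙ ∼ log n` is a harmonic sum
(`IsParkingOnRRT.measure_subtree` and Maclaurin's bound on elementary symmetric sums), and by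
Chernoff's bound a given set of `m` vertices is overfull with probability at most
`√α * (3 / 2 * √α) ^ m`. Hence the expected number of overfull subtrees is of order `α` times a
geometric series of ratio `3 / 2 * √α * Hₙ`, and it tends to `0` when `log n = α ^ (-1/2 + ε)`
(`IsParkingOnRRT.measure_exists_flux_pos_le`).

*Upper bound on `θ`.* A vertex at which two cars arrive, or with two children that send a car to
it, sends a car to its parent. The vertices are cut, by age, into blocks of harmonic length of order
`κ = α ^ (-1/2 - ε/2)`, two blocks forming a level. A vertex at the top level is good if two cars
arrive there, and a vertex at a lower level is good if it has a good child in each of the two blocks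
of the level above it. If the good vertices in each block of some level have reciprocal indices
of sum at least `s ≤ 1`, then one level below they have reciprocal indices of sum at least of order
`κ * s ^ 2`: the mean of the sum is of that order, and, as hitting different vertices is negatively
correlated and the indices are huge, Chebyshev's inequality applies
(`IsParkingOnRRT.measure_recipSum_hitTwice_lt_le`). Since `κ * s` is at least `α ^ (-ε/2)` up to a
constant as soon as `s ≥ α ^ (1/2)`, the sum grows by a power of `α` at every level, and after a
number of levels that depends only on `ε` it is of order `α ^ (-1/2)`. Then the number of good
children of the root is large, and so is the flux (`IsParkingOnRRT.measure_flux_lt_le`).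
-/

/-! ### Flows of cars -/

theorem parkingSpot_notMem {u : AttachSeq} {occ : Finset ℕ} {v w : ℕ}
    (h : parkingSpot u occ v = some w) : w ∉ occ := by
  induction v using Nat.strong_induction_on with
  | _ v ih =>
    cases v with
    | zero =>
      by_cases h0 : 0 ∈ occ
      · simp [parkingSpot, h0] at h
      · simp only [parkingSpot, h0, if_false, Option.some.injEq] at h
        exact h ▸ h0
    | succ k =>
      by_cases h0 : k + 1 ∈ occ
      · rw [parkingSpot, if_pos h0] at h
        exact ih _ (u k).isLt h
      · rw [parkingSpot, if_neg h0, Option.some.injEq] at h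
        exact h ▸ h0

/-- The trajectory of one car, as a flow: `d x` is the number of times (`0` or `1`) that the car
leaves `x` towards the root. -/
theorem exists_flow_of_car (u : AttachSeq) (occ : Finset ℕ) (n v : ℕ) (hv : v < n) :
    ∃ d : ℕ → ℕ, (d 0 = if parkingSpot u occ v = none then 1 else 0) ∧
      (∀ x, d x ≠ 0 → x ∈ occ) ∧
      ∀ x, (if x = v then 1 else 0) +
          (∑ k ∈ Finset.range n, if (u k : ℕ) = x then d (k + 1) else 0) =
        d x + if parkingSpot u occ v = some x then 1 else 0 := by
  induction v using Nat.strong_induction_on with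
  | _ v ih =>
    cases v with
    | zero =>
      by_cases h0 : 0 ∈ occ
      · refine ⟨fun x => if x = 0 then 1 else 0, ?_, ?_, ?_⟩
        · simp [parkingSpot, h0]
        · intro x hx
          have : x = 0 := by simpa using hx
          exact this ▸ h0
        · intro x
          simp [parkingSpot, h0]
      · refine ⟨fun _ => 0, ?_, ?_, ?_⟩
        · simp [parkingSpot, h0]
        · simp
        · intro x
          simp [parkingSpot, h0, eq_comm]
    | succ k =>
      by_cases h0 : k + 1 ∈ occ
      · obtain ⟨d, hd0, hdo, hd⟩ := ih _ (u k).isLt ((u k).isLt.trans hv)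
        have hs : parkingSpot u occ (k + 1) = parkingSpot u occ (u k) := by
          rw [parkingSpot, if_pos h0]
        refine ⟨fun x => d x + if x = k + 1 then 1 else 0, ?_, ?_, ?_⟩
        · simp [hs, hd0]
        · intro x hx
          by_cases hxk : x = k + 1
          · exact hxk ▸ h0
          · exact hdo x (by simpa [hxk] using hx)
        · intro x
          have hsum : (∑ j ∈ Finset.range n,
              if (u j : ℕ) = x then (d (j + 1) + if j + 1 = k + 1 then 1 else 0) else 0) =
              (∑ j ∈ Finset.range n, if (u j : ℕ) = x then d (j + 1) else 0) +
                if x = (u k : ℕ) then 1 else 0 := by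
            have : ∀ j, (if (u j : ℕ) = x then (d (j + 1) + if j + 1 = k + 1 then 1 else 0) else 0)
                = (if (u j : ℕ) = x then d (j + 1) else 0) +
                  if j = k then (if x = (u k : ℕ) then 1 else 0) else 0 := by
              intro j
              by_cases hj : j = k
              · subst hj
                by_cases hx : (u j : ℕ) = x
                · simp [hx]
                · simp [hx, Ne.symm hx]
              · by_cases hx : (u j : ℕ) = x <;> simp [hx, hj]
            rw [Finset.sum_congr rfl fun j _ => this j, Finset.sum_add_distrib,
              Finset.sum_ite_eq' (Finset.range n) k, if_pos (Finset.mem_range.2 (by omega))]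
          have := hd x
          rw [hsum, hs]
          beta_reduce
          omega
      · refine ⟨fun _ => 0, ?_, ?_, ?_⟩
        · simp [parkingSpot, h0]
        · simp
        · intro x
          simp [parkingSpot, h0, eq_comm]

/-- Conservation of cars: `D x` is the number of cars that leave the vertex `x` towards the root,
and the cars that arrive at `x`, directly or from a child, either leave `x` or park there. -/
theorem exists_flow (u : AttachSeq) (n : ℕ) (s : Multiset ℕ) (hs : ∀ v ∈ s, v < n) :
    ∃ D : ℕ → ℕ, D 0 = (s.foldr (parkCar u) (∅, 0)).2 ∧
      (∀ x, D x ≠ 0 → x ∈ (s.foldr (parkCar u) (∅, 0)).1) ∧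
      ∀ x, s.count x + (∑ k ∈ Finset.range n, if (u k : ℕ) = x then D (k + 1) else 0) =
        D x + if x ∈ (s.foldr (parkCar u) (∅, 0)).1 then 1 else 0 := by
  induction s using Multiset.induction_on with
  | empty => exact ⟨fun _ => 0, by simp, by simp, by simp⟩
  | cons v s ih =>
    obtain ⟨D, hD0, hDo, hD⟩ := ih fun w hw => hs w (Multiset.mem_cons_of_mem hw)
    rw [Multiset.foldr_cons]
    generalize s.foldr (parkCar u) (∅, 0) = st at *
    obtain ⟨occ, e⟩ := st
    obtain ⟨d, hd0, hdo, hd⟩ := exists_flow_of_car u occ n v (hs v (Multiset.mem_cons_self v s))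
    have hsum : ∀ x, (∑ k ∈ Finset.range n, if (u k : ℕ) = x then D (k + 1) + d (k + 1) else 0) =
        (∑ k ∈ Finset.range n, if (u k : ℕ) = x then D (k + 1) else 0) +
          ∑ k ∈ Finset.range n, if (u k : ℕ) = x then d (k + 1) else 0 := by
      intro x
      rw [← Finset.sum_add_distrib]
      exact Finset.sum_congr rfl fun k _ => by split_ifs <;> rfl
    refine ⟨fun x => D x + d x, ?_⟩
    rcases hsp : parkingSpot u occ v with _ | w
    · have hp : parkCar u v (occ, e) = (occ, e + 1) := by simp [parkCar, hsp]
      rw [hp]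
      refine ⟨?_, ?_, ?_⟩
      · simp [hd0, hsp, hD0]
      · intro x hx
        by_cases h : D x = 0
        · exact hdo x (by simpa [h] using hx)
        · exact hDo x h
      · intro x
        have h1 := hD x
        have h2 := hd x
        simp only [hsp, reduceCtorEq, if_false] at h2
        rw [hsum, Multiset.count_cons]
        simp only at h1 ⊢
        omega
    · have hp : parkCar u v (occ, e) = (insert w occ, e) := by simp [parkCar, hsp]
      have hw := parkingSpot_notMem hsp
      rw [hp]
      refine ⟨?_, ?_, ?_⟩
      · simp [hd0, hsp, hD0]
      · intro x hx
        refine Finset.mem_insert_of_mem ?_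
        by_cases h : D x = 0
        · exact hdo x (by simpa [h] using hx)
        · exact hDo x h
      · intro x
        have h1 := hD x
        have h2 := hd x
        simp only [hsp, Option.some.injEq] at h2
        rw [hsum, Multiset.count_cons]
        have h3 : (if x ∈ insert w occ then 1 else 0) =
            (if x ∈ occ then 1 else 0) + if w = x then 1 else 0 := by
          by_cases hx : w = x
          · subst hx; simp [hw]
          · have : ¬ x = w := fun h => hx h.symm
            simp [hx, this]
        simp only at h1 ⊢
        omega

theorem mem_arrivingCars_lt {a : ℕ → ℕ} {n v : ℕ} (h : v ∈ arrivingCars a n) : v < n := by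
  simp only [arrivingCars, Multiset.mem_sum, Multiset.mem_replicate, Finset.mem_range] at h
  obtain ⟨k, hk, -, rfl⟩ := h
  exact hk

theorem count_arrivingCars (a : ℕ → ℕ) (n v : ℕ) :
    (arrivingCars a n).count v = if v < n then a v else 0 := by
  simp [arrivingCars, Multiset.count_sum', Multiset.count_replicate]

/-- The vertex set consisting of the root and of the vertices `k + 1` for `k ∈ K`. -/
def vertexSet (K : Finset ℕ) : Finset ℕ :=
  insert 0 (K.image (· + 1))

theorem zero_notMem_image_succ (K : Finset ℕ) : 0 ∉ K.image (· + 1) := by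
  simp

theorem card_vertexSet (K : Finset ℕ) : (vertexSet K).card = K.card + 1 := by
  rw [vertexSet, Finset.card_insert_of_notMem (zero_notMem_image_succ K),
    Finset.card_image_of_injective _ (add_left_injective 1)]

/-- A positive flux is witnessed by a subtree containing the root on which strictly more cars
arrive than it has vertices. -/
theorem exists_overfull_subtree {u : AttachSeq} {a : ℕ → ℕ} {n : ℕ} (h : 0 < flux u a n) :
    ∃ K ⊆ Finset.range (n - 1), (∀ k ∈ K, (u k : ℕ) ∈ vertexSet K) ∧
      (vertexSet K).card + 1 ≤ ∑ v ∈ vertexSet K, a v := by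
  classical
  obtain ⟨D, hD0, hDo, hD⟩ := exists_flow u n (arrivingCars a n) fun v hv => mem_arrivingCars_lt hv
  change D 0 = flux u a n at hD0
  generalize ((arrivingCars a n).foldr (parkCar u) (∅, 0)).1 = occ at *
  have hn : 0 < n := by
    rcases Nat.eq_zero_or_pos n with rfl | hn
    · simp [flux, arrivingCars] at h
    · exact hn
  have h0 : 0 ∈ occ := hDo 0 (by omega)
  -- the vertices from which the root is reached through occupied vertices only
  set T := (Finset.range n).filter fun v => parkingSpot u occ v = none with hT
  have h0T : 0 ∈ T := by simp [hT, hn, parkingSpot, h0]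
  have hTocc : ∀ v ∈ T, v ∈ occ := by
    intro v hv
    have hv := (Finset.mem_filter.1 hv).2
    by_contra hvo
    cases v <;> simp [parkingSpot, hvo] at hv
  have hTpar : ∀ k, k + 1 ∈ T → (u k : ℕ) ∈ T := by
    intro k hk
    have h1 := hTocc _ hk
    obtain ⟨h2, h3⟩ := Finset.mem_filter.1 hk
    rw [parkingSpot, if_pos h1] at h3
    refine Finset.mem_filter.2 ⟨?_, h3⟩
    have := (u k).isLt
    simp only [Finset.mem_range] at h2 ⊢
    omega
  have hoccn : ∀ v, D v ≠ 0 → v < n := by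
    intro v hv
    by_contra hvn
    have h1 := hD v
    rw [count_arrivingCars, if_neg hvn] at h1
    have : ∀ k ∈ Finset.range n, (if (u k : ℕ) = v then D (k + 1) else 0) = 0 := by
      intro k hk
      have := (u k).isLt
      rw [Finset.mem_range] at hk
      rw [if_neg (by omega)]
    rw [Finset.sum_eq_zero this] at h1
    omega
  have hsum : ∑ v ∈ T, a v + ∑ k ∈ Finset.range n, (if (u k : ℕ) ∈ T then D (k + 1) else 0) =
      ∑ v ∈ T, D v + T.card := by
    have h1 : ∀ v ∈ T, a v + (∑ k ∈ Finset.range n, if (u k : ℕ) = v then D (k + 1) else 0) =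
        D v + 1 := by
      intro v hv
      have := hD v
      rwa [count_arrivingCars, if_pos (Finset.mem_range.1 (Finset.mem_filter.1 hv).1),
        if_pos (hTocc v hv)] at this
    have h2 := Finset.sum_congr rfl h1
    rw [Finset.sum_add_distrib, Finset.sum_add_distrib, Finset.sum_comm] at h2
    simpa using h2
  -- no car enters `T` from outside: a child of a vertex of `T` that is not in `T` is free
  have hle : ∑ k ∈ Finset.range n, (if (u k : ℕ) ∈ T then D (k + 1) else 0) ≤
      ∑ v ∈ T.erase 0, D v := by
    have h1 : ∑ k ∈ Finset.range n, (if (u k : ℕ) ∈ T then D (k + 1) else 0) ≤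
        ∑ k ∈ (Finset.range n).filter fun k => k + 1 ∈ T, D (k + 1) := by
      rw [Finset.sum_filter]
      refine Finset.sum_le_sum fun k _ => ?_
      by_cases hk : k + 1 ∈ T
      · rw [if_pos hk]; split_ifs <;> omega
      · rw [if_neg hk]
        split_ifs with hu
        · by_contra hne
          have hD1 : D (k + 1) ≠ 0 := by omega
          refine hk (Finset.mem_filter.2 ⟨Finset.mem_range.2 (hoccn _ hD1), ?_⟩)
          rw [parkingSpot, if_pos (hDo _ hD1)]
          exact (Finset.mem_filter.1 hu).2
        · exact le_rfl
    refine h1.trans ?_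
    rw [← Finset.sum_image (s := (Finset.range n).filter fun k => k + 1 ∈ T) (g := fun k => k + 1)
      (f := D) (fun x _ y _ hxy => by simpa using hxy)]
    refine Finset.sum_le_sum_of_subset fun v hv => ?_
    obtain ⟨k, hk, rfl⟩ := Finset.mem_image.1 hv
    exact Finset.mem_erase.2 ⟨Nat.succ_ne_zero k, (Finset.mem_filter.1 hk).2⟩
  set K := (Finset.range (n - 1)).filter fun k => k + 1 ∈ T with hK
  have hKT : vertexSet K = T := by
    ext v
    cases v with
    | zero => simp [vertexSet, h0T]
    | succ k =>
      have : k + 1 ∈ T → k < n - 1 := fun hk => by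
        have := Finset.mem_range.1 (Finset.mem_filter.1 hk).1
        omega
      simpa [vertexSet, hK] using this
  refine ⟨K, Finset.filter_subset _ _, ?_, ?_⟩
  · intro k hk
    rw [hKT]
    exact hTpar k (Finset.mem_filter.1 hk).2
  · rw [hKT]
    have := Finset.add_sum_erase T D h0T
    omega

/-- Supersolution form of conservation of cars: out of the cars that come to a vertex of `𝕋ₙ`, all
but at most one leave it. -/
theorem exists_flow_arrivingCars (u : AttachSeq) (a : ℕ → ℕ) (n : ℕ) :
    ∃ D : ℕ → ℕ, D 0 = flux u a n ∧ ∀ v < n,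
      a v + (∑ k ∈ Finset.range n, if (u k : ℕ) = v then D (k + 1) else 0) ≤ D v + 1 := by
  obtain ⟨D, hD0, -, hD⟩ := exists_flow u n (arrivingCars a n) fun v hv => mem_arrivingCars_lt hv
  refine ⟨D, hD0, fun v hv => ?_⟩
  have := hD v
  rw [count_arrivingCars, if_pos hv] at this
  rw [this]
  gcongr
  split_ifs <;> simp

/-! ### Overfull subtrees and the first moment -/

theorem pow_succ_add_le (x y : ℝ) (hx : 0 ≤ x) (hy : 0 ≤ y) (m : ℕ) :
    x ^ (m + 1) + (m + 1) * y * x ^ m ≤ (x + y) ^ (m + 1) := by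
  induction m with
  | zero => simp
  | succ m ih =>
    calc x ^ (m + 1 + 1) + ((m + 1 : ℕ) + 1) * y * x ^ (m + 1)
        ≤ (x ^ (m + 1) + (m + 1) * y * x ^ m) * (x + y) := by
          have : 0 ≤ (m + 1) * y * x ^ m * y := by positivity
          push_cast
          rw [pow_succ x (m + 1), pow_succ x m]
          linarith
      _ ≤ (x + y) ^ (m + 1) * (x + y) := by gcongr
      _ = (x + y) ^ (m + 1 + 1) := (pow_succ _ _).symm

/-- Maclaurin's bound for the elementary symmetric sums of nonnegative reals. -/
theorem factorial_mul_sum_powersetCard_prod_le {ι : Type*} [DecidableEq ι] (s : Finset ι)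
    (x : ι → ℝ) (hx : ∀ i, 0 ≤ x i) (m : ℕ) :
    (m.factorial : ℝ) * ∑ K ∈ s.powersetCard m, ∏ i ∈ K, x i ≤ (∑ i ∈ s, x i) ^ m := by
  induction s using Finset.induction_on generalizing m with
  | empty =>
    cases m with
    | zero => simp
    | succ m => simp [Finset.powersetCard_eq_empty.2 (show (∅ : Finset ι).card < m + 1 by simp)]
  | insert a s ha ih =>
    cases m with
    | zero => simp
    | succ m =>
      rw [Finset.powersetCard_succ_insert ha, Finset.sum_union, Finset.sum_image,
        Finset.sum_insert ha, add_comm (x a)]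
      · refine le_trans ?_ (pow_succ_add_le _ _ (Finset.sum_nonneg fun i _ => hx i) (hx a) m)
        have h1 : ∑ K ∈ s.powersetCard m, ∏ i ∈ insert a K, x i =
            x a * ∑ K ∈ s.powersetCard m, ∏ i ∈ K, x i := by
          rw [Finset.mul_sum]
          refine Finset.sum_congr rfl fun K hK => Finset.prod_insert fun haK => ha ?_
          exact (Finset.mem_powersetCard.1 hK).1 haK
        rw [h1, mul_add]
        refine add_le_add (ih (m + 1)) ?_
        have := mul_le_mul_of_nonneg_left (ih m) (mul_nonneg (by positivity : (0 : ℝ) ≤ m + 1) (hx a))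
        rw [Nat.factorial_succ]
        push_cast
        linarith
      · intro K hK L hL hKL
        have hK := fun h => ha ((Finset.mem_powersetCard.1 hK).1 h)
        have hL := fun h => ha ((Finset.mem_powersetCard.1 hL).1 h)
        rw [← Finset.erase_insert hK, ← Finset.erase_insert hL, hKL]
      · rw [Finset.disjoint_left]
        intro K hK hK'
        obtain ⟨L, -, rfl⟩ := Finset.mem_image.1 hK'
        exact ha ((Finset.mem_powersetCard.1 hK).1 (Finset.mem_insert_self a L))

/-- The `j`-th smallest element of `K` contributes the factor `j`. -/
theorem prod_card_filter_lt_add_one (K : Finset ℕ) :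
    ∏ k ∈ K, ((K.filter (· < k)).card + 1) = K.card.factorial := by
  induction K using Finset.induction_on_max with
  | empty => simp
  | insert a K hK ih =>
    have ha : a ∉ K := fun h => lt_irrefl a (hK a h)
    have h1 : (insert a K).filter (· < a) = K := by
      rw [Finset.filter_insert, if_neg (lt_irrefl a)]
      exact Finset.filter_true_of_mem hK
    have h2 : ∀ k ∈ K, (insert a K).filter (· < k) = K.filter (· < k) := fun k hk => by
      rw [Finset.filter_insert, if_neg (not_lt.2 (hK k hk).le)]
    rw [Finset.prod_insert ha, h1, Finset.prod_congr rfl fun k hk => by rw [h2 k hk], ih,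
      Finset.card_insert_of_notMem ha, Nat.factorial_succ]

section Model

variable {Ω : Type*} [MeasurableSpace Ω] {P : Measure Ω}
  {U : (k : ℕ) → Ω → Fin (k + 1)} {A : ℕ → Ω → ℕ} {μ : Measure ℕ}

/-- The attachment `U k` charges only the vertices `0, …, k`, hence the intersection with them. -/
theorem IsParkingOnRRT.measureReal_attach_mem (h : IsParkingOnRRT P U A μ) (k : ℕ) (W : Finset ℕ) :
    P.real {ω | (U k ω : ℕ) ∈ W} = (W.filter (· < k + 1)).card / (k + 1) := by
  classical
  have h1 : {ω | (U k ω : ℕ) ∈ W} = U k ⁻¹' {x | (x : ℕ) ∈ W} := rfl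
  have h2 : Fintype.card {x : Fin (k + 1) | (x : ℕ) ∈ W} = (W.filter (· < k + 1)).card := by
    rw [← Set.toFinset_card]
    refine Finset.card_bij (fun x _ => (x : ℕ)) ?_ (fun x _ y _ hxy => Fin.ext hxy) ?_
    · intro x hx
      exact Finset.mem_filter.2 ⟨(Set.mem_toFinset (s := {x : Fin (k + 1) | (x : ℕ) ∈ W})).1 hx, x.isLt⟩
    · intro w hw
      obtain ⟨hw, hwk⟩ := Finset.mem_filter.1 hw
      exact ⟨⟨w, hwk⟩, Set.mem_toFinset.2 hw, rfl⟩
  rw [h1, measureReal_def, ← Measure.map_apply (h.measurable_attach k) (Set.toFinite _).measurableSet,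
    h.map_attach, PMF.toMeasure_uniformOfFintype_apply _ (Set.toFinite _).measurableSet, h2]
  have h3 : ((k : ENNReal) + 1).toReal = k + 1 := by
    exact_mod_cast ENNReal.toReal_natCast (k + 1)
  simp [ENNReal.toReal_div, h3]

theorem IsParkingOnRRT.measurableSet_hit (h : IsParkingOnRRT P U A μ) (G : Finset ℕ) (w : ℕ) :
    MeasurableSet {ω | ∃ k ∈ G, (U k ω : ℕ) = w} := by
  have : {ω | ∃ k ∈ G, (U k ω : ℕ) = w} = ⋃ k ∈ G, U k ⁻¹' {x | (x : ℕ) = w} := by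
    ext ω; simp
  rw [this]
  exact Finset.measurableSet_biUnion G fun k _ =>
    h.measurable_attach k (Set.toFinite _).measurableSet

/-- The probability that `vertexSet K` is closed under taking parents. -/
theorem IsParkingOnRRT.measure_subtree [IsProbabilityMeasure P] (h : IsParkingOnRRT P U A μ)
    (K : Finset ℕ) :
    P {ω | ∀ k ∈ K, (U k ω : ℕ) ∈ vertexSet K} =
      ENNReal.ofReal (K.card.factorial * ∏ k ∈ K, (1 / ((k : ℝ) + 1))) := by
  have h1 : {ω | ∀ k ∈ K, (U k ω : ℕ) ∈ vertexSet K} =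
      ⋂ k ∈ K, U k ⁻¹' {x | (x : ℕ) ∈ vertexSet K} := by
    ext ω; simp
  have h2 : ∀ k, P (U k ⁻¹' {x | (x : ℕ) ∈ vertexSet K}) =
      ENNReal.ofReal (((K.filter (· < k)).card + 1 : ℕ) * (1 / ((k : ℝ) + 1))) := by
    intro k
    have h3 : ((vertexSet K).filter (· < k + 1)) = vertexSet (K.filter (· < k)) := by
      ext v
      cases v <;> simp [vertexSet]
    have := h.measureReal_attach_mem k (vertexSet K)
    rw [h3, card_vertexSet] at this
    rw [mul_one_div, ← this, ofReal_measureReal]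
    rfl
  rw [h1, h.iIndepFun_attach.measure_inter_preimage_eq_mul K
    (fun k _ => (Set.toFinite _).measurableSet), Finset.prod_congr rfl fun k _ => h2 k,
    ← ENNReal.ofReal_prod_of_nonneg (fun k _ => by positivity), Finset.prod_mul_distrib,
    ← Nat.cast_prod, prod_card_filter_lt_add_one]

theorem lintegral_pow_binaryLaw_le {α : ℝ} (h0 : 0 < α) (h1 : α ≤ 1) :
    ∫⁻ n, ENNReal.ofReal (√α)⁻¹ ^ n ∂(binaryLaw α) ≤ ENNReal.ofReal (3 / 2) := by
  have hs : (√α)⁻¹ ^ 2 = α⁻¹ := by rw [inv_pow, Real.sq_sqrt h0.le]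
  rw [binaryLaw, lintegral_add_measure, lintegral_smul_measure, lintegral_smul_measure,
    lintegral_dirac, lintegral_dirac, pow_zero, ← ENNReal.ofReal_pow (by positivity), hs,
    smul_eq_mul, smul_eq_mul, mul_one, ← ENNReal.ofReal_mul (by positivity),
    ← ENNReal.ofReal_add (by linarith) (by positivity)]
  apply ENNReal.ofReal_le_ofReal
  field_simp
  linarith

/-- Chernoff's bound for the event that more cars arrive on a vertex set than it has vertices. -/
theorem IsParkingOnRRT.measure_overfull_le [IsProbabilityMeasure P] {α : ℝ} (h0 : 0 < α)
    (h1 : α ≤ 1) (h : IsParkingOnRRT P U A (binaryLaw α)) (V : Finset ℕ) :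
    P {ω | V.card + 1 ≤ ∑ v ∈ V, A v ω} ≤ ENNReal.ofReal (√α * (3 / 2 * √α) ^ V.card) := by
  -- with this base the exponential moment of one arrival is bounded, as `α / 2 * y ^ 2 = 1 / 2`
  set y := ENNReal.ofReal (√α)⁻¹ with hy
  have hs : 0 < √α := Real.sqrt_pos.2 h0
  have hy1 : 1 ≤ y := by
    rw [hy, ENNReal.one_le_ofReal, one_le_inv₀ hs, Real.sqrt_le_one]
    exact h1
  have hind : iIndepFun (fun v ω => y ^ A v ω) P :=
    h.iIndepFun_arrival.comp (fun _ n => y ^ n) fun _ => measurable_from_top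
  have hmeas : ∀ v, Measurable fun ω => y ^ A v ω := fun v =>
    (measurable_from_top (f := fun n : ℕ => y ^ n)).comp (h.measurable_arrival v)
  have hE : ∫⁻ ω, ∏ v ∈ V, y ^ A v ω ∂P ≤ ENNReal.ofReal ((3 / 2) ^ V.card) := by
    rw [lintegral_prod_eq_prod_lintegral_of_indepFun V _ hind hmeas,
      ENNReal.ofReal_pow (by norm_num), ← Finset.prod_const]
    refine Finset.prod_le_prod' fun v _ => ?_
    rw [← lintegral_map (f := fun n : ℕ => y ^ n) measurable_from_top (h.measurable_arrival v),
      h.map_arrival]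
    exact lintegral_pow_binaryLaw_le h0 h1
  have hsub : {ω | V.card + 1 ≤ ∑ v ∈ V, A v ω} ⊆ {ω | y ^ (V.card + 1) ≤ ∏ v ∈ V, y ^ A v ω} := by
    intro ω hω
    rw [Set.mem_ofPred_eq, Finset.prod_pow_eq_pow_sum]
    exact pow_le_pow_right₀ hy1 hω
  have hM := (mul_meas_ge_le_lintegral (μ := P) (Finset.measurable_prod V fun v _ => hmeas v)
    (y ^ (V.card + 1))).trans hE
  have hypos : y ^ (V.card + 1) = ENNReal.ofReal ((√α)⁻¹ ^ (V.card + 1)) := by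
    rw [hy, ENNReal.ofReal_pow (by positivity)]
  have hprod : √α * (3 / 2 * √α) ^ V.card = √α ^ (V.card + 1) * (3 / 2) ^ V.card := by ring
  have hinv : ENNReal.ofReal (√α ^ (V.card + 1)) * y ^ (V.card + 1) = 1 := by
    rw [hypos, ← ENNReal.ofReal_mul (by positivity), ← mul_pow, mul_inv_cancel₀ hs.ne', one_pow,
      ENNReal.ofReal_one]
  calc P {ω | V.card + 1 ≤ ∑ v ∈ V, A v ω}
      ≤ P {ω | y ^ (V.card + 1) ≤ ∏ v ∈ V, y ^ A v ω} := measure_mono hsub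
    _ = ENNReal.ofReal (√α ^ (V.card + 1)) *
        (y ^ (V.card + 1) * P {ω | y ^ (V.card + 1) ≤ ∏ v ∈ V, y ^ A v ω}) := by
          rw [← mul_assoc, hinv, one_mul]
    _ ≤ ENNReal.ofReal (√α ^ (V.card + 1)) * ENNReal.ofReal ((3 / 2) ^ V.card) := by gcongr
    _ = _ := by rw [← ENNReal.ofReal_mul (by positivity), ← hprod]

/-- The first moment bound: the expected number of overfull subtrees containing the root is small as
long as `√α` times the harmonic sum is small. -/
theorem IsParkingOnRRT.measure_exists_flux_pos_le [IsProbabilityMeasure P] {α : ℝ} (h0 : 0 < α)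
    (h1 : α ≤ 1) (h : IsParkingOnRRT P U A (binaryLaw α)) (N : ℕ)
    (hN : 3 / 2 * √α * ∑ k ∈ Finset.range N, (1 / ((k : ℝ) + 1)) ≤ 1 / 2) :
    P {ω | ∃ n ≤ N + 1, 0 < flux (fun k => U k ω) (fun k => A k ω) n} ≤
      ENNReal.ofReal (3 * α) := by
  classical
  set H := ∑ k ∈ Finset.range N, (1 / ((k : ℝ) + 1)) with hH
  have hH0 : 0 ≤ H := Finset.sum_nonneg fun k _ => by positivity
  set E : Finset ℕ → Set Ω := fun K => {ω | (∀ k ∈ K, (U k ω : ℕ) ∈ vertexSet K) ∧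
    (vertexSet K).card + 1 ≤ ∑ v ∈ vertexSet K, A v ω} with hE
  set g : Finset ℕ → ℝ := fun K => (K.card.factorial * ∏ k ∈ K, (1 / ((k : ℝ) + 1))) *
    (√α * (3 / 2 * √α) ^ (K.card + 1)) with hg
  have hEK : ∀ K, P (E K) ≤ ENNReal.ofReal (g K) := by
    intro K
    have hU : MeasurableSet {u : AttachSeq | ∀ k ∈ K, (u k : ℕ) ∈ vertexSet K} := by
      have : {u : AttachSeq | ∀ k ∈ K, (u k : ℕ) ∈ vertexSet K} =
          ⋂ k ∈ K, (fun u : AttachSeq => u k) ⁻¹' {x | (x : ℕ) ∈ vertexSet K} := by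
        ext u; simp
      rw [this]
      exact Finset.measurableSet_biInter K fun k _ =>
        measurable_pi_apply k (Set.toFinite _).measurableSet
    have hA : MeasurableSet {a : ℕ → ℕ | (vertexSet K).card + 1 ≤ ∑ v ∈ vertexSet K, a v} :=
      measurableSet_le measurable_const (Finset.measurable_sum _ fun v _ => measurable_pi_apply v)
    have := h.indepFun.measure_inter_preimage_eq_mul _ _ hU hA
    have h2 : E K = (fun ω k => U k ω) ⁻¹' {u : AttachSeq | ∀ k ∈ K, (u k : ℕ) ∈ vertexSet K} ∩
        (fun ω k => A k ω) ⁻¹' {a : ℕ → ℕ | (vertexSet K).card + 1 ≤ ∑ v ∈ vertexSet K, a v} := rfl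
    rw [h2, this, hg, ENNReal.ofReal_mul (by positivity), ← card_vertexSet K]
    exact mul_le_mul' (h.measure_subtree K).le (h.measure_overfull_le h0 h1 (vertexSet K))
  have hsub : {ω | ∃ n ≤ N + 1, 0 < flux (fun k => U k ω) (fun k => A k ω) n} ⊆
      ⋃ K ∈ (Finset.range N).powerset, E K := by
    rintro ω ⟨n, hn, hpos⟩
    obtain ⟨K, hK, hK1, hK2⟩ := exists_overfull_subtree hpos
    refine Set.mem_biUnion (x := K) ?_ ⟨hK1, hK2⟩
    rw [Finset.mem_coe, Finset.mem_powerset]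
    exact hK.trans (Finset.range_subset_range.2 (by omega))
  refine (measure_mono hsub).trans ((measure_biUnion_finset_le _ _).trans
    ((Finset.sum_le_sum fun K _ => hEK K).trans ?_))
  rw [← ENNReal.ofReal_sum_of_nonneg fun K _ => by positivity]
  apply ENNReal.ofReal_le_ofReal
  rw [Finset.sum_powerset]
  set r := 3 / 2 * √α * H with hr
  have hr0 : 0 ≤ r := by positivity
  have hm : ∀ m, ∑ K ∈ (Finset.range N).powersetCard m, g K ≤ 3 / 2 * α * r ^ m := by
    intro m
    have h3 : ∑ K ∈ (Finset.range N).powersetCard m, g K = (m.factorial *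
        ∑ K ∈ (Finset.range N).powersetCard m, ∏ k ∈ K, (1 / ((k : ℝ) + 1))) *
          (√α * (3 / 2 * √α) ^ (m + 1)) := by
      rw [Finset.mul_sum, Finset.sum_mul]
      refine Finset.sum_congr rfl fun K hK => ?_
      simp only [hg, (Finset.mem_powersetCard.1 hK).2]
    rw [h3]
    calc _ ≤ H ^ m * (√α * (3 / 2 * √α) ^ (m + 1)) := by
          gcongr
          exact factorial_mul_sum_powersetCard_prod_le _ _ (fun k => by positivity) m
      _ = 3 / 2 * (√α * √α) * r ^ m := by rw [hr]; ring
      _ = 3 / 2 * α * r ^ m := by rw [Real.mul_self_sqrt h0.le]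
  calc _ ≤ ∑ m ∈ Finset.range ((Finset.range N).card + 1), 3 / 2 * α * r ^ m :=
        Finset.sum_le_sum fun m _ => hm m
    _ = 3 / 2 * α * ∑ m ∈ Finset.range ((Finset.range N).card + 1), r ^ m := by
        rw [Finset.mul_sum]
    _ ≤ 3 / 2 * α * ∑' m : ℕ, r ^ m := by
        gcongr
        exact (summable_geometric_of_lt_one hr0 (by linarith)).sum_le_tsum _
          fun m _ => by positivity
    _ = 3 / 2 * α * (1 - r)⁻¹ := by rw [tsum_geometric_of_lt_one hr0 (by linarith)]
    _ ≤ 3 / 2 * α * 2 := by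
        gcongr
        rw [inv_le_comm₀ (by linarith) (by norm_num)]
        linarith
    _ = 3 * α := by ring

end Model

/-! ### Second moments and independence -/

section Probability

variable {Ω : Type*} [MeasurableSpace Ω] {P : Measure Ω} [IsProbabilityMeasure P]

/-- A second moment bound: a weighted sum of indicators of pairwise negatively correlated events,
with weights at most `b`, is at least half its mean up to a probability `4 * b / m`. -/
theorem measure_sum_indicator_lt_half_le {ι : Type*} (s : Finset ι) (c : ι → ℝ) (F : ι → Set Ω)
    (hF : ∀ i ∈ s, MeasurableSet (F i)) {b m : ℝ} (hc : ∀ i ∈ s, 0 ≤ c i)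
    (hb : ∀ i ∈ s, c i ≤ b) (hcorr : ∀ i ∈ s, ∀ j ∈ s, i ≠ j →
      P.real (F i ∩ F j) ≤ P.real (F i) * P.real (F j))
    (hm : 0 < m) (hmE : m ≤ ∑ i ∈ s, c i * P.real (F i)) :
    P {ω | ∑ i ∈ s, (F i).indicator (fun _ => c i) ω < m / 2} ≤ ENNReal.ofReal (4 * b / m) := by
  classical
  set V : Ω → ℝ := fun ω => ∑ i ∈ s, (F i).indicator (fun _ => c i) ω with hV
  set M := ∑ i ∈ s, c i * P.real (F i) with hM
  have hM0 : 0 < M := hm.trans_le hmE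
  have hb0 : 0 ≤ b := by
    rcases s.eq_empty_or_nonempty with rfl | ⟨i, hi⟩
    · simp [hM] at hM0
    · exact (hc i hi).trans (hb i hi)
  have hL : MemLp V 2 P := memLp_finsetSum s fun i hi =>
    memLp_indicator_const 2 (hF i hi) (c i) (Or.inr (measure_ne_top P _))
  have hEV : ∫ ω, V ω ∂P = M := by
    rw [hV, integral_finsetSum s fun i hi => (integrable_const (c i)).indicator (hF i hi)]
    refine Finset.sum_congr rfl fun i hi => ?_
    rw [integral_indicator_const _ (hF i hi), smul_eq_mul, mul_comm]
  have hEV2 : ∫ ω, (V ^ 2) ω ∂P = ∑ i ∈ s, ∑ j ∈ s, c i * c j * P.real (F i ∩ F j) := by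
    have h1 : ∀ ω, (V ^ 2) ω =
        ∑ i ∈ s, ∑ j ∈ s, (F i ∩ F j).indicator (fun _ => c i * c j) ω := by
      intro ω
      rw [Pi.pow_apply, pow_two, hV, Finset.sum_mul_sum]
      refine Finset.sum_congr rfl fun i _ => Finset.sum_congr rfl fun j _ => ?_
      rw [Set.inter_indicator_mul]
    simp_rw [h1]
    have hint : ∀ i ∈ s, ∀ j ∈ s,
        Integrable ((F i ∩ F j).indicator fun _ => c i * c j) P := fun i hi j hj =>
      (integrable_const _).indicator ((hF i hi).inter (hF j hj))
    rw [integral_finsetSum s fun i hi => integrable_finsetSum s fun j hj => hint i hi j hj]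
    refine Finset.sum_congr rfl fun i hi => ?_
    rw [integral_finsetSum s fun j hj => hint i hi j hj]
    refine Finset.sum_congr rfl fun j hj => ?_
    rw [integral_indicator_const _ ((hF i hi).inter (hF j hj)), smul_eq_mul, mul_comm]
  have hle : ∑ i ∈ s, ∑ j ∈ s, c i * c j * P.real (F i ∩ F j) ≤ M ^ 2 + b * M := by
    have h1 : M ^ 2 + b * M = ∑ i ∈ s, ∑ j ∈ s,
        (c i * P.real (F i) * (c j * P.real (F j)) + if i = j then b * (c i * P.real (F i)) else 0) := by
      simp_rw [Finset.sum_add_distrib]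
      rw [pow_two, hM, Finset.sum_mul_sum, Finset.mul_sum]
      congr 1
      refine Finset.sum_congr rfl fun i hi => ?_
      rw [Finset.sum_ite_eq, if_pos hi]
    rw [h1]
    refine Finset.sum_le_sum fun i hi => Finset.sum_le_sum fun j hj => ?_
    have hci := hc i hi
    have hcj := hc j hj
    by_cases hij : i = j
    · subst hij
      rw [if_pos rfl, Set.inter_self]
      have h2 : c i * (c i * P.real (F i)) ≤ b * (c i * P.real (F i)) :=
        mul_le_mul_of_nonneg_right (hb i hi) (by positivity)
      have h3 : 0 ≤ c i * P.real (F i) * (c i * P.real (F i)) := by positivity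
      linarith
    · rw [if_neg hij, add_zero]
      have := mul_le_mul_of_nonneg_left (hcorr i hi j hj hij) (mul_nonneg hci hcj)
      linarith
  have hvar : variance V P ≤ b * M := by
    rw [variance_eq_sub hL, hEV2, hEV]
    linarith
  have hsub : {ω | V ω < m / 2} ⊆ {ω | M / 2 ≤ |V ω - ∫ ω, V ω ∂P|} := by
    intro ω hω
    have hω : V ω < m / 2 := hω
    rw [Set.mem_ofPred_eq, hEV, abs_sub_comm]
    exact le_trans (by linarith) (le_abs_self _)
  refine (measure_mono hsub).trans ((meas_ge_le_variance_div_sq hL (by positivity)).trans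
    (ENNReal.ofReal_le_ofReal ?_))
  calc variance V P / (M / 2) ^ 2 ≤ b * M / (M / 2) ^ 2 := by gcongr
    _ = 4 * b / M := by field_simp; ring
    _ ≤ 4 * b / m := by gcongr

/-- Bounding the probability of an event by conditioning on an independent discrete variable. -/
theorem measure_mem_le_add_of_indep {β : Type*} [Countable β] (X : Ω → β) (Q : Set β)
    (E : β → Set Ω) {δ : ENNReal} (hX : ∀ b, MeasurableSet (X ⁻¹' {b}))
    (hind : ∀ b, P (X ⁻¹' {b} ∩ E b) = P (X ⁻¹' {b}) * P (E b)) (hE : ∀ b ∈ Q, P (E b) ≤ δ) :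
    P {ω | ω ∈ E (X ω)} ≤ P {ω | X ω ∉ Q} + δ := by
  have hsub : {ω | ω ∈ E (X ω)} ⊆ {ω | X ω ∉ Q} ∪ ⋃ b : Q, (X ⁻¹' {(b : β)} ∩ E b) := by
    intro ω hω
    by_cases h : X ω ∈ Q
    · exact Or.inr (Set.mem_iUnion.2 ⟨⟨X ω, h⟩, rfl, hω⟩)
    · exact Or.inl h
  refine (measure_mono hsub).trans ((measure_union_le _ _).trans (add_le_add le_rfl ?_))
  calc P (⋃ b : Q, (X ⁻¹' {(b : β)} ∩ E b)) ≤ ∑' b : Q, P (X ⁻¹' {(b : β)} ∩ E b) :=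
        measure_iUnion_le _
    _ ≤ ∑' b : Q, P (X ⁻¹' {(b : β)}) * δ := by
        refine ENNReal.tsum_le_tsum fun b => ?_
        rw [hind]
        exact mul_le_mul' le_rfl (hE b b.2)
    _ = P (⋃ b : Q, X ⁻¹' {(b : β)}) * δ := by
        rw [ENNReal.tsum_mul_right,
          measure_iUnion (f := fun b : Q => X ⁻¹' {(b : β)}) ?_ fun b => hX b]
        intro a b hab
        refine Set.disjoint_left.2 fun ω ha hb => hab (Subtype.ext ?_)
        exact (show X ω = a from ha).symm.trans hb
    _ ≤ 1 * δ := mul_le_mul' prob_le_one le_rfl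
    _ = δ := one_mul δ

end Probability

section Attachment

variable {Ω : Type*} [MeasurableSpace Ω] {P : Measure Ω} {U : (k : ℕ) → Ω → Fin (k + 1)}

theorem DependsOn.exists_eq_comp_restrict {β : Type*} {f : AttachSeq → β} {S : Finset ℕ}
    (hf : DependsOn f (S : Set ℕ)) :
    ∃ g : ((k : S) → Fin ((k : ℕ) + 1)) → β, ∀ u : AttachSeq, f u = g fun k => u k := by
  have : Nonempty β := ⟨f fun _ => 0⟩
  obtain ⟨g, hg⟩ := dependsOn_iff_exists_comp.1 hf
  exact ⟨g, fun u => congrFun hg u⟩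

theorem measurable_comp_of_dependsOn (hm : ∀ k, Measurable (U k)) {β : Type*} [MeasurableSpace β]
    {f : AttachSeq → β} {S : Finset ℕ} (hf : DependsOn f (S : Set ℕ)) :
    Measurable fun ω => f fun k => U k ω := by
  obtain ⟨g, hg⟩ := hf.exists_eq_comp_restrict
  simp_rw [hg]
  exact (Measurable.of_discrete (f := g)).comp (measurable_pi_lambda _ fun k => hm k)

theorem indepFun_comp_of_dependsOn (hU : iIndepFun U P) (hm : ∀ k, Measurable (U k))
    {β γ : Type*} [MeasurableSpace β] [MeasurableSpace γ] {f : AttachSeq → β} {g : AttachSeq → γ}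
    {S T : Finset ℕ} (hf : DependsOn f (S : Set ℕ)) (hg : DependsOn g (T : Set ℕ))
    (hST : Disjoint S T) :
    IndepFun (fun ω => f fun k => U k ω) (fun ω => g fun k => U k ω) P := by
  obtain ⟨f', hf'⟩ := hf.exists_eq_comp_restrict
  obtain ⟨g', hg'⟩ := hg.exists_eq_comp_restrict
  simp_rw [hf', hg']
  exact (hU.indepFun_finset S T hST hm).comp (Measurable.of_discrete (f := f'))
    (Measurable.of_discrete (f := g'))

end Attachment

/-! ### Hitting older vertices -/

/-- The sum of `1 / (k + 1)`, the probability for the vertex `k + 1` to be attached to a given older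
vertex, over `k ∈ G`. -/
noncomputable def recipSum (G : Finset ℕ) : ℝ :=
  ∑ k ∈ G, 1 / ((k : ℝ) + 1)

/-- The probability that a given old vertex has a child `k + 1` with `k ∈ G`. -/
noncomputable def hitProb (G : Finset ℕ) : ℝ :=
  1 - ∏ k ∈ G, (1 - 1 / ((k : ℝ) + 1))

theorem half_min_le_hitProb {G : Finset ℕ} {s : ℝ} (h0 : 0 ≤ s) (hs : s ≤ recipSum G) :
    min s 1 / 2 ≤ hitProb G := by
  have h1 : ∏ k ∈ G, (1 - 1 / ((k : ℝ) + 1)) ≤ Real.exp (-recipSum G) := by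
    rw [recipSum, ← Finset.sum_neg_distrib, Real.exp_sum]
    refine Finset.prod_le_prod (fun k _ => ?_) fun k _ => ?_
    · rw [sub_nonneg, div_le_one (by positivity)]
      linarith [(Nat.cast_nonneg k : (0 : ℝ) ≤ k)]
    · exact Real.one_sub_le_exp_neg _
  set m := min s 1 with hm
  have hm0 : 0 ≤ m := le_min h0 zero_le_one
  have hm1 : m ≤ 1 := min_le_right _ _
  have h2 : Real.exp (-recipSum G) ≤ Real.exp (-m) :=
    Real.exp_le_exp.2 (neg_le_neg ((min_le_left _ _).trans hs))
  have h3 : Real.exp (-m) ≤ 1 - m / 2 := by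
    rw [Real.exp_neg, inv_le_comm₀ (Real.exp_pos m) (by linarith)]
    refine le_trans ?_ (Real.add_one_le_exp m)
    rw [inv_le_iff_one_le_mul₀ (by linarith)]
    nlinarith
  rw [hitProb]
  linarith

section Model

variable {Ω : Type*} [MeasurableSpace Ω] {P : Measure Ω} [IsProbabilityMeasure P]
  {U : (k : ℕ) → Ω → Fin (k + 1)} {A : ℕ → Ω → ℕ} {μ : Measure ℕ}

/-- As `W` consists of vertices older than those in question, `U k` avoids it with probability
`1 - W.card / (k + 1)`. -/
theorem IsParkingOnRRT.measureReal_forall_notMem (h : IsParkingOnRRT P U A μ) (G W : Finset ℕ)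
    (hGW : ∀ k ∈ G, ∀ w ∈ W, w ≤ k) :
    P.real {ω | ∀ k ∈ G, (U k ω : ℕ) ∉ W} = ∏ k ∈ G, (1 - W.card / ((k : ℝ) + 1)) := by
  have h1 : {ω | ∀ k ∈ G, (U k ω : ℕ) ∉ W} = ⋂ k ∈ G, U k ⁻¹' {x | (x : ℕ) ∉ W} := by
    ext ω; simp
  rw [h1, measureReal_def, h.iIndepFun_attach.measure_inter_preimage_eq_mul G
    (fun k _ => (Set.toFinite _).measurableSet), ENNReal.toReal_prod]
  refine Finset.prod_congr rfl fun k hk => ?_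
  have h2 : U k ⁻¹' {x | (x : ℕ) ∉ W} = {ω | (U k ω : ℕ) ∈ W}ᶜ := rfl
  have h3 : MeasurableSet {ω | (U k ω : ℕ) ∈ W} :=
    h.measurable_attach k (Set.toFinite {x : Fin (k + 1) | (x : ℕ) ∈ W}).measurableSet
  rw [← measureReal_def, h2, probReal_compl_eq_one_sub h3, h.measureReal_attach_mem,
    Finset.filter_true_of_mem fun w hw => Nat.lt_succ_of_le (hGW k hk w hw)]

theorem IsParkingOnRRT.measureReal_hit (h : IsParkingOnRRT P U A μ) (G : Finset ℕ) (w : ℕ)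
    (hG : ∀ k ∈ G, w ≤ k) : P.real {ω | ∃ k ∈ G, (U k ω : ℕ) = w} = hitProb G := by
  have h1 := h.measureReal_forall_notMem G {w} (by simpa using hG)
  have h2 : {ω | ∀ k ∈ G, (U k ω : ℕ) ∉ ({w} : Finset ℕ)} =
      {ω | ∃ k ∈ G, (U k ω : ℕ) = w}ᶜ := by
    ext ω; simp
  rw [h2, probReal_compl_eq_one_sub (h.measurableSet_hit G w), Finset.card_singleton,
    Nat.cast_one] at h1
  rw [hitProb, ← h1]
  ring

/-- Being hit is negatively correlated for different vertices. -/
theorem IsParkingOnRRT.measureReal_hit_inter_le (h : IsParkingOnRRT P U A μ) (G : Finset ℕ)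
    {v w : ℕ} (hvw : v ≠ w) (hv : ∀ k ∈ G, v ≤ k) (hw : ∀ k ∈ G, w ≤ k) :
    P.real ({ω | ∃ k ∈ G, (U k ω : ℕ) = v} ∩ {ω | ∃ k ∈ G, (U k ω : ℕ) = w}) ≤
      hitProb G ^ 2 := by
  set S := {ω | ∃ k ∈ G, (U k ω : ℕ) = v} with hS
  set T := {ω | ∃ k ∈ G, (U k ω : ℕ) = w} with hT
  have h1 := h.measureReal_forall_notMem G {v, w} (by
    intro k hk x hx
    rcases Finset.mem_insert.1 hx with rfl | hx
    · exact hv k hk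
    · exact Finset.mem_singleton.1 hx ▸ hw k hk)
  have h2 : {ω | ∀ k ∈ G, (U k ω : ℕ) ∉ ({v, w} : Finset ℕ)} = (S ∪ T)ᶜ := by
    ext ω
    simp only [hS, hT, Finset.mem_insert, Finset.mem_singleton, Set.mem_ofPred_eq,
      Set.mem_compl_iff, Set.mem_union]
    constructor
    · rintro hx (⟨k, hk, e⟩ | ⟨k, hk, e⟩)
      · exact hx k hk (Or.inl e)
      · exact hx k hk (Or.inr e)
    · rintro hx k hk (e | e)
      · exact hx (Or.inl ⟨k, hk, e⟩)
      · exact hx (Or.inr ⟨k, hk, e⟩)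
  have hSm := h.measurableSet_hit G v
  have hTm := h.measurableSet_hit G w
  rw [h2, probReal_compl_eq_one_sub (hSm.union hTm), Finset.card_pair hvw] at h1
  have h3 : ∏ k ∈ G, (1 - ((2 : ℕ) : ℝ) / ((k : ℝ) + 1)) ≤
      (∏ k ∈ G, (1 - 1 / ((k : ℝ) + 1))) ^ 2 := by
    rw [← Finset.prod_pow]
    refine Finset.prod_le_prod (fun k hk => ?_) fun k hk => ?_
    · have : 1 ≤ k := by
        have := hv k hk
        have := hw k hk
        omega
      have : (1 : ℝ) ≤ k := by exact_mod_cast this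
      rw [sub_nonneg, div_le_one (by positivity)]
      push_cast
      linarith
    · have : 0 ≤ (1 / ((k : ℝ) + 1)) ^ 2 := by positivity
      have h4 : ((2 : ℕ) : ℝ) / ((k : ℝ) + 1) = 2 * (1 / ((k : ℝ) + 1)) := by push_cast; ring
      rw [h4]
      linarith
  have h4 := measureReal_union_add_inter (μ := P) (s := S) hTm
  have h5 : P.real S = hitProb G := h.measureReal_hit G v hv
  have h6 : P.real T = hitProb G := h.measureReal_hit G w hw
  have h7 : ∏ k ∈ G, (1 - 1 / ((k : ℝ) + 1)) = 1 - hitProb G := by rw [hitProb]; ring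
  rw [h7] at h3
  linarith

end Model

/-- The indices `k ∈ B` for which the vertex `k + 1` has a child `j + 1` with `j ∈ G₁` and a child
`j + 1` with `j ∈ G₂`. -/
def hitTwice (u : AttachSeq) (G₁ G₂ B : Finset ℕ) : Finset ℕ :=
  B.filter fun k => (∃ j ∈ G₁, (u j : ℕ) = k + 1) ∧ ∃ j ∈ G₂, (u j : ℕ) = k + 1

theorem dependsOn_hitTwice (G₁ G₂ B : Finset ℕ) :
    DependsOn (fun u => hitTwice u G₁ G₂ B) ((G₁ ∪ G₂ : Finset ℕ) : Set ℕ) := by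
  intro u u' huu'
  have h1 : ∀ j ∈ G₁, u j = u' j := fun j hj => huu' j (by simp [hj])
  have h2 : ∀ j ∈ G₂, u j = u' j := fun j hj => huu' j (by simp [hj])
  refine Finset.filter_congr fun k _ => and_congr ?_ ?_
  · exact exists_congr fun j => and_congr_right fun hj => by rw [h1 j hj]
  · exact exists_congr fun j => and_congr_right fun hj => by rw [h2 j hj]

section Model

variable {Ω : Type*} [MeasurableSpace Ω] {P : Measure Ω} [IsProbabilityMeasure P]
  {U : (k : ℕ) → Ω → Fin (k + 1)} {A : ℕ → Ω → ℕ} {μ : Measure ℕ}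

/-- If the vertices of `G₁` and of `G₂` each have reciprocal sum at least `s`, then those vertices of
`B` that have a child in both have reciprocal sum of order at least `(min s 1) ^ 2 * recipSum B`,
up to a small probability. -/
theorem IsParkingOnRRT.measure_recipSum_hitTwice_lt_le (h : IsParkingOnRRT P U A μ)
    {G₁ G₂ B : Finset ℕ} (hG : Disjoint G₁ G₂) (hB₁ : ∀ j ∈ G₁, ∀ k ∈ B, k < j)
    (hB₂ : ∀ j ∈ G₂, ∀ k ∈ B, k < j) {s b c t : ℝ} (hs0 : 0 ≤ s) (hs₁ : s ≤ recipSum G₁)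
    (hs₂ : s ≤ recipSum G₂) (hc : 0 ≤ c) (hcB : c ≤ recipSum B)
    (hb : ∀ k ∈ B, 1 / ((k : ℝ) + 1) ≤ b) (ht : 0 < t) (htc : 2 * t ≤ (min s 1 / 2) ^ 2 * c) :
    P {ω | recipSum (hitTwice (fun k => U k ω) G₁ G₂ B) < t} ≤ ENNReal.ofReal (2 * b / t) := by
  set F₁ : ℕ → Set Ω := fun k => {ω | ∃ j ∈ G₁, (U j ω : ℕ) = k + 1} with hF₁
  set F₂ : ℕ → Set Ω := fun k => {ω | ∃ j ∈ G₂, (U j ω : ℕ) = k + 1} with hF₂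
  have hdep : ∀ (G : Finset ℕ) (W : Finset ℕ),
      DependsOn (fun u : AttachSeq => ∀ w ∈ W, ∃ j ∈ G, (u j : ℕ) = w) (G : Set ℕ) := by
    intro G W u u' huu'
    refine propext (forall₂_congr fun w _ => exists_congr fun j => and_congr_right fun hj => ?_)
    rw [huu' j hj]
  have hind : ∀ W : Finset ℕ, P.real ({ω | ∀ w ∈ W, ∃ j ∈ G₁, (U j ω : ℕ) = w} ∩
      {ω | ∀ w ∈ W, ∃ j ∈ G₂, (U j ω : ℕ) = w}) =
      P.real {ω | ∀ w ∈ W, ∃ j ∈ G₁, (U j ω : ℕ) = w} *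
        P.real {ω | ∀ w ∈ W, ∃ j ∈ G₂, (U j ω : ℕ) = w} := by
    intro W
    have h1 := indepFun_comp_of_dependsOn h.iIndepFun_attach h.measurable_attach
      (hdep G₁ W) (hdep G₂ W) hG
    have h2 := h1.measure_inter_preimage_eq_mul {p | p} {p | p} (Set.toFinite _).measurableSet
      (Set.toFinite _).measurableSet
    rw [measureReal_def, measureReal_def, measureReal_def, ← ENNReal.toReal_mul]
    exact congrArg ENNReal.toReal h2
  have hreal : ∀ k ∈ B, P.real (F₁ k ∩ F₂ k) = hitProb G₁ * hitProb G₂ := by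
    intro k hk
    have := hind {k + 1}
    simp only [Finset.mem_singleton, forall_eq] at this
    rw [hF₁, hF₂, this, h.measureReal_hit G₁ (k + 1) fun j hj => hB₁ j hj k hk,
      h.measureReal_hit G₂ (k + 1) fun j hj => hB₂ j hj k hk]
  have hq₁ := half_min_le_hitProb hs0 hs₁
  have hq₂ := half_min_le_hitProb hs0 hs₂
  have hq0 : 0 ≤ min s 1 / 2 := div_nonneg (le_min hs0 zero_le_one) zero_le_two
  have hmeas : ∀ k ∈ B, MeasurableSet (F₁ k ∩ F₂ k) := fun k _ =>
    (h.measurableSet_hit G₁ (k + 1)).inter (h.measurableSet_hit G₂ (k + 1))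
  -- negative correlation in each of the independent parts `G₁` and `G₂` gives it for both together
  have hcorr : ∀ k ∈ B, ∀ l ∈ B, k ≠ l → P.real ((F₁ k ∩ F₂ k) ∩ (F₁ l ∩ F₂ l)) ≤
      P.real (F₁ k ∩ F₂ k) * P.real (F₁ l ∩ F₂ l) := by
    intro k hk l hl hkl
    rw [hreal k hk, hreal l hl, Set.inter_inter_inter_comm]
    have := hind {k + 1, l + 1}
    simp only [Finset.mem_insert, Finset.mem_singleton, forall_eq_or_imp, forall_eq] at this
    have h1 := h.measureReal_hit_inter_le G₁ (v := k + 1) (w := l + 1) (by omega)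
      (fun j hj => hB₁ j hj k hk) (fun j hj => hB₁ j hj l hl)
    have h2 := h.measureReal_hit_inter_le G₂ (v := k + 1) (w := l + 1) (by omega)
      (fun j hj => hB₂ j hj k hk) (fun j hj => hB₂ j hj l hl)
    calc P.real ((F₁ k ∩ F₁ l) ∩ (F₂ k ∩ F₂ l))
        = P.real (F₁ k ∩ F₁ l) * P.real (F₂ k ∩ F₂ l) := this
      _ ≤ hitProb G₁ ^ 2 * hitProb G₂ ^ 2 := mul_le_mul h1 h2 measureReal_nonneg (by positivity)
      _ = hitProb G₁ * hitProb G₂ * (hitProb G₁ * hitProb G₂) := by ring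
  have hmean : 2 * t ≤ ∑ k ∈ B, 1 / ((k : ℝ) + 1) * P.real (F₁ k ∩ F₂ k) := by
    rw [Finset.sum_congr rfl fun k hk => by rw [hreal k hk], ← Finset.sum_mul]
    calc 2 * t ≤ (min s 1 / 2) ^ 2 * c := htc
      _ = c * (min s 1 / 2 * (min s 1 / 2)) := by ring
      _ ≤ recipSum B * (hitProb G₁ * hitProb G₂) :=
          mul_le_mul hcB (mul_le_mul hq₁ hq₂ hq0 (hq0.trans hq₁)) (by positivity) (hc.trans hcB)
  have := measure_sum_indicator_lt_half_le (P := P) B (fun k => 1 / ((k : ℝ) + 1))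
    (fun k => F₁ k ∩ F₂ k) hmeas (fun k _ => by positivity) hb hcorr (by positivity) hmean
  have he : 4 * b / (2 * t) = 2 * b / t := by field_simp; ring
  rw [he, mul_div_cancel_left₀ t two_ne_zero] at this
  refine le_trans (measure_mono fun ω hω => ?_) this
  refine lt_of_eq_of_lt ?_ (show recipSum (hitTwice (fun k => U k ω) G₁ G₂ B) < t from hω)
  classical
  rw [recipSum, hitTwice, Finset.sum_filter]
  refine Finset.sum_congr rfl fun k _ => ?_
  rw [Set.indicator_apply]
  congr

theorem IsParkingOnRRT.measure_card_root_children_lt_le (h : IsParkingOnRRT P U A μ)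
    (G : Finset ℕ) {m : ℝ} (hm : 0 < m) (hG : m ≤ recipSum G) :
    P {ω | ((G.filter fun k => (U k ω : ℕ) = 0).card : ℝ) < m / 2} ≤ ENNReal.ofReal (4 / m) := by
  classical
  set F : ℕ → Set Ω := fun k => U k ⁻¹' {x | (x : ℕ) = 0} with hF
  have hreal : ∀ k, P.real (F k) = 1 / ((k : ℝ) + 1) := by
    intro k
    have := h.measureReal_attach_mem k {0}
    have h1 : Finset.filter (· < k + 1) ({0} : Finset ℕ) = {0} := by
      ext x
      simp
      omega
    rw [h1, Finset.card_singleton, Nat.cast_one] at this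
    rw [← this]
    congr 1
    ext ω
    simp [hF]
  have hcorr : ∀ k ∈ G, ∀ l ∈ G, k ≠ l → P.real (F k ∩ F l) ≤ P.real (F k) * P.real (F l) := by
    intro k _ l _ hkl
    rw [measureReal_def, measureReal_def, measureReal_def, ← ENNReal.toReal_mul]
    rw [(h.iIndepFun_attach.indepFun hkl).measure_inter_preimage_eq_mul _ _
      (Set.toFinite _).measurableSet (Set.toFinite _).measurableSet]
  have := measure_sum_indicator_lt_half_le (P := P) (b := 1) G (fun _ => 1) F
    (fun k _ => h.measurable_attach k (Set.toFinite _).measurableSet) (fun _ _ => zero_le_one)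
    (fun _ _ => le_rfl) hcorr hm (by simpa [hreal, recipSum] using hG)
  rw [mul_one] at this
  refine le_trans (measure_mono fun ω hω => ?_) this
  refine lt_of_eq_of_lt ?_
    (show ((G.filter fun k => (U k ω : ℕ) = 0).card : ℝ) < m / 2 from hω)
  rw [Finset.card_filter, Nat.cast_sum]
  refine Finset.sum_congr rfl fun k _ => ?_
  rw [Set.indicator_apply, Nat.cast_ite, Nat.cast_one, Nat.cast_zero]
  congr

theorem IsParkingOnRRT.measure_recipSum_pairs_lt_le {α : ℝ} (h0 : 0 ≤ α)
    (h : IsParkingOnRRT P U A (binaryLaw α)) {B : Finset ℕ} {b t : ℝ}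
    (hb : ∀ k ∈ B, 1 / ((k : ℝ) + 1) ≤ b) (ht : 0 < t) (htB : 2 * t ≤ α / 2 * recipSum B) :
    P {ω | recipSum (B.filter fun k => A (k + 1) ω = 2) < t} ≤ ENNReal.ofReal (2 * b / t) := by
  classical
  set F : ℕ → Set Ω := fun k => A (k + 1) ⁻¹' {2} with hF
  have hreal : ∀ k, P.real (F k) = α / 2 := by
    intro k
    rw [hF, measureReal_def, ← Measure.map_apply (h.measurable_arrival (k + 1))
      (measurableSet_singleton 2), h.map_arrival, binaryLaw]
    have : 0 ≤ α / 2 := by positivity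
    simp [this]
  have hcorr : ∀ k ∈ B, ∀ l ∈ B, k ≠ l → P.real (F k ∩ F l) ≤ P.real (F k) * P.real (F l) := by
    intro k _ l _ hkl
    rw [measureReal_def, measureReal_def, measureReal_def, ← ENNReal.toReal_mul]
    rw [(h.iIndepFun_arrival.indepFun (i := k + 1) (j := l + 1)
      (by omega)).measure_inter_preimage_eq_mul _ _
      (measurableSet_singleton 2) (measurableSet_singleton 2)]
  have hmean : 2 * t ≤ ∑ k ∈ B, 1 / ((k : ℝ) + 1) * P.real (F k) := by
    rw [Finset.sum_congr rfl fun k hk => by rw [hreal k], ← Finset.sum_mul, mul_comm _ (α / 2)]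
    exact htB
  have := measure_sum_indicator_lt_half_le (P := P) B (fun k => 1 / ((k : ℝ) + 1)) F
    (fun k _ => h.measurable_arrival _ (measurableSet_singleton 2)) (fun k _ => by positivity) hb
    hcorr (by positivity) hmean
  have he : 4 * b / (2 * t) = 2 * b / t := by field_simp; ring
  rw [he, mul_div_cancel_left₀ t two_ne_zero] at this
  refine le_trans (measure_mono fun ω hω => ?_) this
  refine lt_of_eq_of_lt ?_ (show recipSum (B.filter fun k => A (k + 1) ω = 2) < t from hω)
  rw [recipSum, Finset.sum_filter]
  refine Finset.sum_congr rfl fun k _ => ?_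
  rw [Set.indicator_apply]
  congr

end Model

/-! ### Passing cars down from level to level -/

/-- The `i`-th block of indices; blocks have harmonic length of order `κ`. As everywhere below, the
index `k` stands for the vertex `k + 1`, whose parent is `u k`. -/
def block (κ i : ℕ) : Finset ℕ :=
  Finset.Ico (2 ^ (κ * i)) (2 ^ (κ * (i + 1)))

theorem lt_of_mem_block {κ i j k l : ℕ} (hij : i < j) (hk : k ∈ block κ i) (hl : l ∈ block κ j) :
    k < l :=
  (Finset.mem_Ico.1 hk).2.trans_le
    ((Nat.pow_le_pow_right two_pos (Nat.mul_le_mul_left κ hij)).trans (Finset.mem_Ico.1 hl).1)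

theorem disjoint_block {κ i j : ℕ} (hij : i < j) : Disjoint (block κ i) (block κ j) :=
  Finset.disjoint_left.2 fun _ hi hj => lt_irrefl _ (lt_of_mem_block hij hi hj)

theorem half_le_recipSum_Ico (a κ : ℕ) :
    (κ : ℝ) / 2 ≤ recipSum (Finset.Ico (2 ^ a) (2 ^ (a + κ))) := by
  induction κ with
  | zero => simp [recipSum]
  | succ κ ih =>
    have h1 : recipSum (Finset.Ico (2 ^ a) (2 ^ (a + (κ + 1)))) =
        recipSum (Finset.Ico (2 ^ a) (2 ^ (a + κ))) +
          recipSum (Finset.Ico (2 ^ (a + κ)) (2 ^ (a + κ + 1))) :=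
      (Finset.sum_Ico_consecutive _ (Nat.pow_le_pow_right two_pos (by omega))
        (Nat.pow_le_pow_right two_pos (by omega))).symm
    have h2 : (1 : ℝ) / 2 ≤ recipSum (Finset.Ico (2 ^ (a + κ)) (2 ^ (a + κ + 1))) := by
      have h3 : ∀ k ∈ Finset.Ico (2 ^ (a + κ)) (2 ^ (a + κ + 1) : ℕ),
          1 / (2 : ℝ) ^ (a + κ + 1) ≤ 1 / ((k : ℝ) + 1) := by
        intro k hk
        have : k + 1 ≤ 2 ^ (a + κ + 1) := (Finset.mem_Ico.1 hk).2
        have : (k : ℝ) + 1 ≤ 2 ^ (a + κ + 1) := by exact_mod_cast this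
        gcongr
      have h4 := Finset.card_nsmul_le_sum _ _ _ h3
      have h5 : 2 ^ (a + κ + 1) - 2 ^ (a + κ) = 2 ^ (a + κ) := by
        rw [pow_succ, Nat.mul_two, Nat.add_sub_cancel]
      rw [Nat.card_Ico, h5, nsmul_eq_mul] at h4
      refine le_trans (le_of_eq ?_) h4
      rw [pow_succ]
      push_cast
      field_simp
    rw [h1]
    push_cast
    linarith

theorem half_le_recipSum_block (κ i : ℕ) : (κ : ℝ) / 2 ≤ recipSum (block κ i) :=
  half_le_recipSum_Ico (κ * i) κ

theorem one_div_le_of_mem_block {κ i k : ℕ} (hκ : 0 < κ) (hi : 0 < i) (hk : k ∈ block κ i) :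
    1 / ((k : ℝ) + 1) ≤ 1 / κ := by
  have h1 : κ ≤ k := calc
    κ ≤ 2 ^ κ := Nat.lt_two_pow_self.le
    _ ≤ 2 ^ (κ * i) := Nat.pow_le_pow_right two_pos (Nat.le_mul_of_pos_right κ hi)
    _ ≤ k := (Finset.mem_Ico.1 hk).1
  have h2 : (κ : ℝ) ≤ k := by exact_mod_cast h1
  have h3 : (0 : ℝ) < κ := by exact_mod_cast hκ
  gcongr
  linarith

/-- The indices at level `l`, one half of which lies in the block `2 * l + 1` and the other half in
the block `2 * l + 2`. -/
def levelSet (κ l : ℕ) : Finset ℕ :=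
  block κ (2 * l + 1) ∪ block κ (2 * l + 2)

/-- The indices of level `l` whose vertices have a child in both halves of the part `G` of the
level `l + 1`. -/
def nextLevel (κ l : ℕ) (G : Finset ℕ) (u : AttachSeq) : Finset ℕ :=
  hitTwice u (G ∩ block κ (2 * l + 3)) (G ∩ block κ (2 * l + 4)) (levelSet κ l)

/-- The number of children of the root in the block `1` that result from the part `G` of level `l`
by passing down from level to level. -/
def rootHits (κ : ℕ) : ℕ → Finset ℕ → AttachSeq → ℕ
  | 0, G, u => ((G ∩ block κ 1).filter fun k => (u k : ℕ) = 0).card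
  | l + 1, G, u => rootHits κ l (nextLevel κ l G u) u

/-- Both halves of the part `G` of level `l` have reciprocal sum at least `t`. -/
def IsFilled (κ l : ℕ) (t : ℝ) (G : Finset ℕ) : Prop :=
  t ≤ recipSum (G ∩ block κ (2 * l + 1)) ∧ t ≤ recipSum (G ∩ block κ (2 * l + 2))

theorem dependsOn_nextLevel (κ l : ℕ) (G : Finset ℕ) :
    DependsOn (nextLevel κ l G) ((levelSet κ (l + 1) : Finset ℕ) : Set ℕ) := by
  refine (dependsOn_hitTwice _ _ _).mono (Finset.coe_subset.2 ?_)
  exact Finset.union_subset_union Finset.inter_subset_right Finset.inter_subset_right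

theorem levelSet_subset_Ico (κ l : ℕ) :
    levelSet κ l ⊆ Finset.Ico (2 ^ (κ * (2 * l + 1))) (2 ^ (κ * (2 * l + 3))) := by
  refine Finset.union_subset (Finset.Ico_subset_Ico le_rfl ?_) (Finset.Ico_subset_Ico ?_ le_rfl) <;>
  exact Nat.pow_le_pow_right two_pos (Nat.mul_le_mul_left κ (by omega))

theorem dependsOn_rootHits (κ l : ℕ) (G : Finset ℕ) :
    DependsOn (rootHits κ l G) ((Finset.range (2 ^ (κ * (2 * l + 3))) : Finset ℕ) : Set ℕ) := by
  induction l generalizing G with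
  | zero =>
    intro u u' huu'
    refine congrArg Finset.card (Finset.filter_congr fun k hk => ?_)
    have h1 := (Finset.mem_Ico.1 (Finset.mem_inter.1 hk).2).2
    rw [huu' k (Finset.mem_coe.2 (Finset.mem_range.2 (h1.trans_le
      (Nat.pow_le_pow_right two_pos (Nat.mul_le_mul_left κ (by omega))))))]
  | succ l ih =>
    intro u u' huu'
    have h1 : nextLevel κ l G u = nextLevel κ l G u' := dependsOn_nextLevel κ l G fun k hk =>
      huu' k (Finset.mem_coe.2 (Finset.mem_range.2
        (Finset.mem_Ico.1 (levelSet_subset_Ico κ (l + 1) (Finset.mem_coe.1 hk))).2))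
    rw [rootHits, rootHits, h1]
    refine ih _ fun k hk => huu' k (Finset.mem_coe.2 (Finset.mem_range.2 ?_))
    exact (Finset.mem_range.1 (Finset.mem_coe.1 hk)).trans_le
      (Nat.pow_le_pow_right two_pos (Nat.mul_le_mul_left κ (by omega)))

theorem hitTwice_inter {u : AttachSeq} {G₁ G₂ B B' : Finset ℕ} (h : B' ⊆ B) :
    hitTwice u G₁ G₂ B ∩ B' = hitTwice u G₁ G₂ B' := by
  rw [hitTwice, hitTwice, Finset.filter_inter, Finset.inter_eq_right.2 h]

/-- A vertex with two children that send a car to it sends a car to its parent, so that cars on the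
part `G` of level `l` result in `rootHits κ l G u` cars at the root. -/
theorem rootHits_le {κ l n : ℕ} {u : AttachSeq} {D : ℕ → ℕ} (hn : 2 ^ (κ * (2 * l + 3)) < n)
    (hD : ∀ v < n, (∑ k ∈ Finset.range n, if (u k : ℕ) = v then D (k + 1) else 0) ≤ D v + 1)
    {G : Finset ℕ} (hG : ∀ k ∈ G, 1 ≤ D (k + 1)) : rootHits κ l G u ≤ D 0 + 1 := by
  induction l generalizing G with
  | zero =>
    refine le_trans ?_ (hD 0 (Nat.zero_lt_of_lt hn))
    rw [rootHits, Finset.card_filter]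
    have hsub : G ∩ block κ 1 ⊆ Finset.range n := by
      intro k hk
      have h1 := (Finset.mem_Ico.1 (Finset.mem_inter.1 hk).2).2
      have h2 : 2 ^ (κ * (1 + 1)) ≤ 2 ^ (κ * (2 * 0 + 3)) :=
        Nat.pow_le_pow_right two_pos (Nat.mul_le_mul_left κ (by omega))
      exact Finset.mem_range.2 (by omega)
    refine le_trans (Finset.sum_le_sum fun k hk => ?_) (Finset.sum_le_sum_of_subset hsub)
    have := hG k (Finset.mem_inter.1 hk).1
    split_ifs <;> omega
  | succ l ih =>
    rw [rootHits]
    have hn' : 2 ^ (κ * (2 * l + 3)) < n := lt_of_le_of_lt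
      (Nat.pow_le_pow_right two_pos (Nat.mul_le_mul_left κ (by omega))) hn
    refine ih hn' fun k hk => ?_
    obtain ⟨hkl, ⟨i, hi, hui⟩, ⟨j, hj, huj⟩⟩ := Finset.mem_filter.1 hk
    obtain ⟨hiG, hi⟩ := Finset.mem_inter.1 hi
    obtain ⟨hjG, hj⟩ := Finset.mem_inter.1 hj
    have hk2 := (Finset.mem_Ico.1 (levelSet_subset_Ico κ l hkl)).2
    have hij : i < j := lt_of_mem_block (Nat.lt_succ_self _) hi hj
    have hjn := (Finset.mem_Ico.1
      (levelSet_subset_Ico κ (l + 1) (Finset.mem_union_right _ hj))).2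
    have h1 := hD (k + 1) (by omega)
    have hsub : ({i, j} : Finset ℕ) ⊆ Finset.range n := by
      intro x hx
      rw [Finset.mem_range]
      rcases Finset.mem_insert.1 hx with rfl | hx
      · omega
      · rw [Finset.mem_singleton.1 hx]; omega
    have h2 := (Finset.sum_le_sum_of_subset (f := fun m => if (u m : ℕ) = k + 1 then D (m + 1) else 0)
      hsub).trans h1
    rw [Finset.sum_pair hij.ne, if_pos hui, if_pos huj] at h2
    have h3 := hG i hiG
    have h4 := hG j hjG
    omega

theorem measure_not_isFilled_le {Ω : Type*} [MeasurableSpace Ω] {P : Measure Ω} {κ l : ℕ} {t b : ℝ}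
    {G : Ω → Finset ℕ} (hb : 0 ≤ b)
    (h₁ : P {ω | recipSum (G ω ∩ block κ (2 * l + 1)) < t} ≤ ENNReal.ofReal b)
    (h₂ : P {ω | recipSum (G ω ∩ block κ (2 * l + 2)) < t} ≤ ENNReal.ofReal b) :
    P {ω | ¬ IsFilled κ l t (G ω)} ≤ ENNReal.ofReal (2 * b) := by
  have hsub : {ω | ¬ IsFilled κ l t (G ω)} ⊆
      {ω | recipSum (G ω ∩ block κ (2 * l + 1)) < t} ∪
        {ω | recipSum (G ω ∩ block κ (2 * l + 2)) < t} := by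
    intro ω hω
    rcases not_and_or.1 hω with h | h
    · exact Or.inl (not_le.1 h)
    · exact Or.inr (not_le.1 h)
  refine (measure_mono hsub).trans ((measure_union_le _ _).trans ((add_le_add h₁ h₂).trans ?_))
  rw [← ENNReal.ofReal_add hb hb, two_mul]

section Model

variable {Ω : Type*} [MeasurableSpace Ω] {P : Measure Ω} [IsProbabilityMeasure P]
  {U : (k : ℕ) → Ω → Fin (k + 1)} {A : ℕ → Ω → ℕ} {μ : Measure ℕ}

theorem IsParkingOnRRT.measure_not_isFilled_nextLevel_le (h : IsParkingOnRRT P U A μ) {κ l : ℕ}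
    (hκ : 0 < κ) {s t : ℝ} (hs : 0 ≤ s) (ht : 0 < t) (hst : t ≤ κ * min s 1 ^ 2 / 16)
    {G : Finset ℕ} (hG : IsFilled κ (l + 1) s G) :
    P {ω | ¬ IsFilled κ l t (nextLevel κ l G fun k => U k ω)} ≤ ENNReal.ofReal (4 / (κ * t)) := by
  have hκ' : (0 : ℝ) < κ := by exact_mod_cast hκ
  have key : ∀ i, 0 < i → i < 2 * l + 3 → block κ i ⊆ levelSet κ l →
      P {ω | recipSum (nextLevel κ l G (fun k => U k ω) ∩ block κ i) < t} ≤
        ENNReal.ofReal (2 * (1 / κ) / t) := by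
    intro i hi hil hsub
    simp_rw [nextLevel, hitTwice_inter hsub]
    refine h.measure_recipSum_hitTwice_lt_le (s := s) (c := κ / 2) ?_ ?_ ?_ hs hG.1 hG.2
      (by positivity) (half_le_recipSum_block κ i)
      (fun k hk => one_div_le_of_mem_block hκ hi hk) ht ?_
    · exact (disjoint_block (Nat.lt_succ_self _)).mono Finset.inter_subset_right
        Finset.inter_subset_right
    · intro j hj k hk
      exact lt_of_mem_block hil hk (Finset.mem_inter.1 hj).2
    · intro j hj k hk
      exact lt_of_mem_block (by omega) hk (Finset.mem_inter.1 hj).2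
    · linarith
  have h3 := measure_not_isFilled_le (P := P) (by positivity)
    (key (2 * l + 1) (by omega) (by omega) Finset.subset_union_left)
    (key (2 * l + 2) (by omega) (by omega) Finset.subset_union_right)
  have h4 : 2 * (2 * (1 / (κ : ℝ)) / t) = 4 / (κ * t) := by field_simp; ring
  rwa [h4] at h3

/-- Starting from a filled level `l`, about `τ 0` cars reach the root with high probability. -/
theorem IsParkingOnRRT.measure_rootHits_lt_le (h : IsParkingOnRRT P U A μ) {κ : ℕ} (hκ : 0 < κ)
    {τ : ℕ → ℝ} (hτ0 : ∀ l, 0 < τ l) {δ : ℝ} (hδ0 : 0 ≤ δ) (l : ℕ)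
    (hτ : ∀ i < l, τ i ≤ κ * min (τ (i + 1)) 1 ^ 2 / 16) (hδ : ∀ i < l, 4 / (κ * τ i) ≤ δ)
    {G : Finset ℕ} (hG : IsFilled κ l (τ l) G) :
    P {ω | (rootHits κ l G (fun k => U k ω) : ℝ) < τ 0 / 2} ≤
      ENNReal.ofReal (l * δ + 4 / τ 0) := by
  induction l generalizing G with
  | zero =>
    simp only [Nat.cast_zero, zero_mul, zero_add]
    exact h.measure_card_root_children_lt_le _ (hτ0 0) hG.1
  | succ l ih =>
    have hstage := h.measure_not_isFilled_nextLevel_le hκ (hτ0 (l + 1)).le (hτ0 l)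
      (hτ l (Nat.lt_succ_self l)) hG
    set X : Ω → Finset ℕ := fun ω => nextLevel κ l G fun k => U k ω with hX
    set E : Finset ℕ → Set Ω := fun G' =>
      {ω | (rootHits κ l G' (fun k => U k ω) : ℝ) < τ 0 / 2} with hE
    let _ : MeasurableSpace (Finset ℕ) := ⊤
    have hXm : Measurable X :=
      measurable_comp_of_dependsOn h.measurable_attach (dependsOn_nextLevel κ l G)
    have hdisj : Disjoint (levelSet κ (l + 1)) (Finset.range (2 ^ (κ * (2 * l + 3)))) := by
      refine Finset.disjoint_left.2 fun k hk hk' => ?_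
      have h1 := (Finset.mem_Ico.1 (levelSet_subset_Ico κ (l + 1) hk)).1
      have h2 := Finset.mem_range.1 hk'
      rw [show 2 * (l + 1) + 1 = 2 * l + 3 by ring] at h1
      omega
    -- the stage uses the attachments of level `l + 1`, the later stages those of lower levels
    have hind : ∀ G', P (X ⁻¹' {G'} ∩ E G') = P (X ⁻¹' {G'}) * P (E G') := fun G' =>
      (indepFun_comp_of_dependsOn h.iIndepFun_attach h.measurable_attach
        (dependsOn_nextLevel κ l G) (dependsOn_rootHits κ l G') hdisj).measure_inter_preimage_eq_mul
        {G'} {m | (m : ℝ) < τ 0 / 2} trivial (MeasurableSet.of_discrete)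
    have := measure_mem_le_add_of_indep X {G' | IsFilled κ l (τ l) G'} E
      (fun G' => hXm trivial) hind fun G' hG' =>
        ih (fun i hi => hτ i (hi.trans (Nat.lt_succ_self l)))
          (fun i hi => hδ i (hi.trans (Nat.lt_succ_self l))) hG'
    refine this.trans ((add_le_add hstage le_rfl).trans ?_)
    have h0 := hτ0 0
    rw [← ENNReal.ofReal_add (div_nonneg (by norm_num) (mul_nonneg (Nat.cast_nonneg κ) (hτ0 l).le))
      (by positivity)]
    apply ENNReal.ofReal_le_ofReal
    have := hδ l (Nat.lt_succ_self l)
    push_cast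
    linarith

/-- The flux of `𝕋ₙ` is at least of order `τ 0` with high probability. -/
theorem IsParkingOnRRT.measure_flux_lt_le {α : ℝ} (h0 : 0 ≤ α)
    (h : IsParkingOnRRT P U A (binaryLaw α)) {κ : ℕ} (hκ : 0 < κ)
    {τ : ℕ → ℝ} (hτ0 : ∀ l, 0 < τ l) {δ : ℝ} (J : ℕ)
    (hτ : ∀ i < J, τ i ≤ κ * min (τ (i + 1)) 1 ^ 2 / 16) (hδ : ∀ i ≤ J, 4 / (κ * τ i) ≤ δ)
    (hτJ : τ J ≤ α * κ / 8) {n : ℕ} (hn : 2 ^ (κ * (2 * J + 3)) < n) :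
    P {ω | (flux (fun k => U k ω) (fun k => A k ω) n : ℝ) + 1 < τ 0 / 2} ≤
      ENNReal.ofReal ((J + 1) * δ + 4 / τ 0) := by
  have hκ' : (0 : ℝ) < κ := by exact_mod_cast hκ
  have hδ0 : 0 ≤ δ :=
    le_trans (div_nonneg (by norm_num) (mul_nonneg hκ'.le (hτ0 J).le)) (hδ J le_rfl)
  -- the indices at the top level whose vertices receive two cars
  set G : (ℕ → ℕ) → Finset ℕ := fun a => (levelSet κ J).filter fun k => a (k + 1) = 2 with hG
  set X : Ω → Finset ℕ := fun ω => G fun k => A k ω with hX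
  set E : Finset ℕ → Set Ω := fun G' =>
    {ω | (rootHits κ J G' (fun k => U k ω) : ℝ) < τ 0 / 2} with hE
  let _ : MeasurableSpace (Finset ℕ) := ⊤
  have hGm : ∀ G', MeasurableSet (G ⁻¹' {G'}) := by
    intro G'
    have h1 : G ⁻¹' {G'} = {a | ∀ k, k ∈ G a ↔ k ∈ G'} := by
      ext a; exact Finset.ext_iff
    rw [h1, Set.ofPred_forall]
    refine MeasurableSet.iInter fun k => ?_
    have h2 : Measurable fun a : ℕ → ℕ => (k ∈ levelSet κ J ∧ a (k + 1) = 2 ↔ k ∈ G') :=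
      (Measurable.of_discrete (f := fun m : ℕ => (k ∈ levelSet κ J ∧ m = 2 ↔ k ∈ G'))).comp
        (measurable_pi_apply (k + 1))
    simpa [hG] using measurableSet_setOfPred.2 h2
  have hAm : Measurable fun ω k => A k ω := measurable_pi_lambda _ h.measurable_arrival
  have hind : ∀ G', P (X ⁻¹' {G'} ∩ E G') = P (X ⁻¹' {G'}) * P (E G') := by
    intro G'
    have h1 : MeasurableSet {u : AttachSeq | (rootHits κ J G' u : ℝ) < τ 0 / 2} := by
      have h2 : Measurable fun u : AttachSeq => rootHits κ J G' fun k => u k :=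
        measurable_comp_of_dependsOn (U := fun k (u : AttachSeq) => u k) measurable_pi_apply
          (dependsOn_rootHits κ J G')
      exact h2 (MeasurableSet.of_discrete (s := {m : ℕ | (m : ℝ) < τ 0 / 2}))
    have h3 := h.indepFun.measure_inter_preimage_eq_mul _ _ h1 (hGm G')
    rw [Set.inter_comm, mul_comm]
    exact h3
  have hfill : P {ω | ¬ IsFilled κ J (τ J) (X ω)} ≤ ENNReal.ofReal δ := by
    have key : ∀ i, 0 < i → block κ i ⊆ levelSet κ J →
        P {ω | recipSum (X ω ∩ block κ i) < τ J} ≤ ENNReal.ofReal (2 * (1 / κ) / τ J) := by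
      intro i hi hsub
      have h1 : ∀ ω, X ω ∩ block κ i = (block κ i).filter fun k => A (k + 1) ω = 2 := by
        intro ω
        rw [hX, hG, Finset.filter_inter, Finset.inter_eq_right.2 hsub]
      simp_rw [h1]
      refine h.measure_recipSum_pairs_lt_le h0 (fun k hk => one_div_le_of_mem_block hκ hi hk)
        (hτ0 J) ?_
      have := mul_le_mul_of_nonneg_left (half_le_recipSum_block κ i) (div_nonneg h0 zero_le_two)
      linarith
    have h3 := measure_not_isFilled_le (P := P)
      (div_nonneg (by positivity) (hτ0 J).le)
      (key (2 * J + 1) (by omega) Finset.subset_union_left)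
      (key (2 * J + 2) (by omega) Finset.subset_union_right)
    refine h3.trans (ENNReal.ofReal_le_ofReal (le_trans (le_of_eq ?_) (hδ J le_rfl)))
    have := (hτ0 J).ne'
    field_simp
    ring
  have hmain := measure_mem_le_add_of_indep X {G' | IsFilled κ J (τ J) G'} E
    (fun G' => hAm (hGm G')) hind fun G' hG' => h.measure_rootHits_lt_le hκ hτ0 hδ0 J hτ
      (fun i hi => hδ i hi.le) hG'
  have hsub : {ω | (flux (fun k => U k ω) (fun k => A k ω) n : ℝ) + 1 < τ 0 / 2} ⊆
      {ω | ω ∈ E (X ω)} := by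
    intro ω hω
    have hω : (flux (fun k => U k ω) (fun k => A k ω) n : ℝ) + 1 < τ 0 / 2 := hω
    obtain ⟨D, hD0, hD⟩ := exists_flow_arrivingCars (fun k => U k ω) (fun k => A k ω) n
    have h1 : rootHits κ J (X ω) (fun k => U k ω) ≤ D 0 + 1 := by
      refine rootHits_le hn (fun v hv => le_trans (Nat.le_add_left _ _) (hD v hv)) fun k hk => ?_
      obtain ⟨hk1, hk2⟩ := Finset.mem_filter.1 hk
      have h2 := (Finset.mem_Ico.1 (levelSet_subset_Ico κ J hk1)).2
      have h3 := hD (k + 1) (by omega)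
      have hk2 : A (k + 1) ω = 2 := hk2
      rw [hk2] at h3
      omega
    rw [hD0] at h1
    have h2 : (rootHits κ J (X ω) (fun k => U k ω) : ℝ) ≤
        flux (fun k => U k ω) (fun k => A k ω) n + 1 := by exact_mod_cast h1
    exact lt_of_le_of_lt h2 hω
  refine (measure_mono hsub).trans (hmain.trans ((add_le_add hfill le_rfl).trans ?_))
  have := hτ0 0
  rw [← ENNReal.ofReal_add hδ0 (by positivity)]
  apply ENNReal.ofReal_le_ofReal
  linarith

end Model

/-! ### The time of appearance -/

theorem logLog_mono : Monotone logLog := fun a b hab => by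
  unfold logLog
  exact ENNReal.log_monotone (EReal.toENNReal_le_toENNReal (ENNReal.log_monotone (by gcongr)))

theorem logLog_natCast {n : ℕ} (hn : 2 ≤ n) :
    logLog (n : ℕ∞) = ((Real.log (Real.log n) : ℝ) : EReal) := by
  have h1 : (1 : ℝ) < n := by exact_mod_cast hn
  have h2 : (((n : ℕ∞) : ENNReal)) = ENNReal.ofReal n := by simp
  rw [logLog, h2, ENNReal.log_ofReal_of_pos (by linarith), EReal.toENNReal_of_ne_top (EReal.coe_ne_top _),
    EReal.toReal_coe, ENNReal.log_ofReal_of_pos (Real.log_pos h1)]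

theorem appearanceTime_le {u : AttachSeq} {a : ℕ → ℕ} {C : ℝ} {n : ℕ} (h : C ≤ flux u a n) :
    appearanceTime u a C ≤ n :=
  sInf_le ⟨n, h, rfl⟩

theorem succ_le_appearanceTime {u : AttachSeq} {a : ℕ → ℕ} {C : ℝ} (hC : 0 < C) {N : ℕ}
    (h : ¬ ∃ n ≤ N, 0 < flux u a n) : ((N + 1 : ℕ) : ℕ∞) ≤ appearanceTime u a C := by
  refine le_sInf ?_
  rintro _ ⟨n, hn, rfl⟩
  have h1 : 0 < flux u a n := by
    have : (0 : ℝ) < flux u a n := hC.trans_le hn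
    exact_mod_cast this
  refine Nat.cast_le.2 ?_
  by_contra h2
  exact h ⟨n, by omega, h1⟩

/-- The bound `2 ≤ n` keeps `logLog n` away from its value `⊥` at `1`. -/
theorem lt_logLog_div {n : ℕ} (hn : 2 ≤ n) {θ : ℕ∞} (hθ : (n : ℕ∞) ≤ θ) {x c : ℝ} (hx : 0 < x)
    (h : Real.exp (c * x) < Real.log n) : (c : EReal) < logLog θ / (x : EReal) := by
  refine lt_of_lt_of_le ?_ (EReal.div_le_div_right_of_nonneg (EReal.coe_nonneg.2 hx.le)
    (logLog_mono hθ))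
  rw [logLog_natCast hn, ← EReal.coe_div, EReal.coe_lt_coe_iff, lt_div_iff₀ hx,
    Real.lt_log_iff_exp_lt ((Real.exp_pos _).trans h)]
  exact h

theorem logLog_div_lt {n : ℕ} (hn : 2 ≤ n) {θ : ℕ∞} (hθ : θ ≤ n) {x c : ℝ} (hx : 0 < x)
    (h : Real.log n < Real.exp (c * x)) : logLog θ / (x : EReal) < (c : EReal) := by
  refine lt_of_le_of_lt (EReal.div_le_div_right_of_nonneg (EReal.coe_nonneg.2 hx.le)
    (logLog_mono hθ)) ?_
  have h1 : (1 : ℝ) < n := by exact_mod_cast hn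
  rw [logLog_natCast hn, ← EReal.coe_div, EReal.coe_lt_coe_iff, div_lt_iff₀ hx,
    Real.log_lt_iff_lt_exp (Real.log_pos h1)]
  exact h

theorem exp_mul_abs_log {α : ℝ} (h0 : 0 < α) (h1 : α < 1) (c : ℝ) :
    Real.exp (c * |Real.log α|) = α ^ (-c) := by
  rw [abs_of_neg (Real.log_neg h0 h1), Real.rpow_def_of_pos h0]
  congr 1
  ring

theorem tendsto_rpow_nhdsGT_zero {c : ℝ} (hc : 0 < c) :
    Tendsto (fun α : ℝ => α ^ c) (𝓝[>] 0) (𝓝 0) := by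
  have := (Real.continuousAt_rpow_const 0 c (Or.inr hc.le)).tendsto
  rw [Real.zero_rpow hc.ne'] at this
  exact this.mono_left nhdsWithin_le_nhds

section Model

variable {Ω : Type*} [MeasurableSpace Ω] {P : Measure Ω} [IsProbabilityMeasure P]
  {U : (k : ℕ) → Ω → Fin (k + 1)} {A : ℕ → Ω → ℕ}

/-- The lower bound on the time of appearance, at a fixed parameter. -/
theorem IsParkingOnRRT.measure_logLog_le_le {α ε C : ℝ} (h0 : 0 < α) (h1 : α < 1) (hC : 0 < C)
    (h : IsParkingOnRRT P U A (binaryLaw α)) (hα : 3 / 2 * (α ^ (1 / 2 : ℝ) + α ^ ε) ≤ 1 / 2) :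
    P {ω | ¬ ((1 / 2 - ε : ℝ) : EReal) <
      logLog (appearanceTime (fun k => U k ω) (fun k => A k ω) C) / ((|Real.log α| : ℝ) : EReal)} ≤
      ENNReal.ofReal (3 * α) := by
  set Y := α ^ (-(1 / 2 - ε)) with hY
  have hY0 : 0 < Y := Real.rpow_pos_of_pos h0 _
  set N := ⌊Real.exp Y⌋₊ with hN
  have hN1 : 1 ≤ N := Nat.le_floor (by simpa using hY0.le)
  have hN2 : (N : ℝ) ≤ Real.exp Y := Nat.floor_le (Real.exp_pos Y).le
  have hN3 : Real.exp Y < (N : ℝ) + 1 := Nat.lt_floor_add_one _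
  have hsum : ∑ k ∈ Finset.range N, 1 / ((k : ℝ) + 1) ≤ 1 + Y := by
    have h2 := harmonic_le_one_add_log N
    have h3 : ((harmonic N : ℚ) : ℝ) = ∑ k ∈ Finset.range N, 1 / ((k : ℝ) + 1) := by
      simp [harmonic]
    rw [h3] at h2
    have h4 : Real.log N ≤ Y := by
      rw [Real.log_le_iff_le_exp (by exact_mod_cast hN1)]
      exact hN2
    linarith
  have hr : 3 / 2 * √α * ∑ k ∈ Finset.range N, 1 / ((k : ℝ) + 1) ≤ 1 / 2 := by
    refine le_trans ?_ hα
    have h2 : √α * Y = α ^ ε := by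
      rw [Real.sqrt_eq_rpow, hY, ← Real.rpow_add h0]
      congr 1
      ring
    calc 3 / 2 * √α * ∑ k ∈ Finset.range N, 1 / ((k : ℝ) + 1) ≤ 3 / 2 * √α * (1 + Y) := by gcongr
      _ = 3 / 2 * (√α + √α * Y) := by ring
      _ = 3 / 2 * (α ^ (1 / 2 : ℝ) + α ^ ε) := by rw [h2, Real.sqrt_eq_rpow]
  refine (measure_mono fun ω hω => ?_).trans (h.measure_exists_flux_pos_le h0 h1.le N hr)
  by_contra hno
  refine hω (lt_logLog_div (n := N + 1 + 1) (by omega) (succ_le_appearanceTime hC hno)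
    (abs_pos.2 (Real.log_neg h0 h1).ne) ?_)
  rw [exp_mul_abs_log h0 h1, Real.lt_log_iff_exp_lt (by positivity)]
  push_cast
  linarith

/-- The upper bound on the time of appearance, at a fixed parameter. The reciprocal sum `j` levels
below the top one is shown to be at least `α ^ max (-1 / 2) (1 / 2 - j * ε / 4)`. -/
theorem IsParkingOnRRT.measure_le_logLog_le {α ε C : ℝ} (h0 : 0 < α) (h1 : α < 1) (hε : 0 < ε)
    (h : IsParkingOnRRT P U A (binaryLaw α)) {J : ℕ} (hJ : 4 / ε ≤ J)
    (h16 : α ^ (ε / 4) ≤ 1 / 16) (hC : (C + 1) * α ^ (1 / 2 : ℝ) ≤ 1 / 2)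
    (hN : (4 * J + 8) * α ^ (ε / 2) < 1) :
    P {ω | ¬ logLog (appearanceTime (fun k => U k ω) (fun k => A k ω) C) /
      ((|Real.log α| : ℝ) : EReal) < ((1 / 2 + ε : ℝ) : EReal)} ≤
      ENNReal.ofReal ((J + 1) * (4 * α ^ (ε / 2)) + 4 * α ^ (1 / 2 : ℝ)) := by
  have hmono : ∀ {x y : ℝ}, x ≤ y → α ^ y ≤ α ^ x := fun hxy =>
    Real.rpow_le_rpow_of_exponent_ge h0 h1.le hxy
  have hpos : ∀ x : ℝ, 0 < α ^ x := fun x => Real.rpow_pos_of_pos h0 x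
  have hone : ∀ {x : ℝ}, x ≤ 0 → 1 ≤ α ^ x := fun hx =>
    Real.one_le_rpow_of_pos_of_le_one_of_nonpos h0 h1.le hx
  set κ := ⌈α ^ (-(1 / 2 + ε / 2))⌉₊ with hκ
  have hκ1 : α ^ (-(1 / 2 + ε / 2)) ≤ κ := Nat.le_ceil _
  have hκ2 : (κ : ℝ) ≤ 2 * α ^ (-(1 / 2 + ε / 2)) := by
    have := Nat.ceil_lt_add_one (hpos (-(1 / 2 + ε / 2))).le
    have := hone (x := -(1 / 2 + ε / 2)) (by linarith)
    linarith
  have hκ0 : 0 < κ := Nat.ceil_pos.2 (hpos _)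
  have hκ0' : (0 : ℝ) < κ := by exact_mod_cast hκ0
  -- below a level with sum at least `1` the sum is only known to be of order `κ`, whence the cap
  set e : ℕ → ℝ := fun l => max (-(1 / 2)) (1 / 2 - ((J : ℝ) - l) * (ε / 4)) with he
  set τ : ℕ → ℝ := fun l => α ^ e l with hτdef
  have hτ0 : ∀ l, 0 < τ l := fun l => hpos _
  have hle : ∀ l ≤ J, e l ≤ 1 / 2 := by
    intro l hl
    have : (l : ℝ) ≤ J := by exact_mod_cast hl
    have : 0 ≤ ((J : ℝ) - l) * (ε / 4) := by
      apply mul_nonneg <;> linarith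
    exact max_le (by norm_num) (by linarith)
  have heJ : e J = 1 / 2 := by
    simp only [he, sub_self, zero_mul, sub_zero]
    norm_num
  have he0 : e 0 = -(1 / 2) := by
    rw [div_le_iff₀ hε] at hJ
    refine max_eq_left ?_
    rw [Nat.cast_zero]
    linarith
  have hτ : ∀ i < J, τ i ≤ κ * min (τ (i + 1)) 1 ^ 2 / 16 := by
    intro i hi
    have h2 : min (τ (i + 1)) 1 = α ^ max (e (i + 1)) 0 := by
      rcases le_total (e (i + 1)) 0 with h3 | h3
      · rw [max_eq_right h3, Real.rpow_zero, min_eq_right (hone h3)]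
      · rw [max_eq_left h3, min_eq_left (Real.rpow_le_one h0.le h1.le h3)]
    have h3 : -(1 / 2 + ε / 2) + (max (e (i + 1)) 0 + max (e (i + 1)) 0) + ε / 4 ≤ e i := by
      have h4 : -(1 / 2) ≤ e i := le_max_left _ _
      have h5 : 1 / 2 - ((J : ℝ) - i) * (ε / 4) ≤ e i := le_max_right _ _
      have h6 := hle (i + 1) hi
      rcases le_total (e (i + 1)) 0 with h7 | h7
      · rw [max_eq_right h7]; linarith
      · rw [max_eq_left h7]
        rcases max_choice (-(1 / 2)) (1 / 2 - ((J : ℝ) - (i + 1 : ℕ)) * (ε / 4)) with h8 | h8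
        · have : e (i + 1) = -(1 / 2) := h8
          linarith
        · have h9 : e (i + 1) = 1 / 2 - ((J : ℝ) - (i + 1 : ℕ)) * (ε / 4) := h8
          push_cast at h9
          linarith
    calc τ i ≤ α ^ (-(1 / 2 + ε / 2) + (max (e (i + 1)) 0 + max (e (i + 1)) 0) + ε / 4) := hmono h3
      _ = α ^ (-(1 / 2 + ε / 2)) * (α ^ max (e (i + 1)) 0) ^ 2 * α ^ (ε / 4) := by
          rw [Real.rpow_add h0, Real.rpow_add h0, Real.rpow_add h0, pow_two]
      _ ≤ κ * (α ^ max (e (i + 1)) 0) ^ 2 * (1 / 16) := by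
          have := hpos (ε / 4)
          gcongr
      _ = κ * min (τ (i + 1)) 1 ^ 2 / 16 := by rw [h2]; ring
  have hδ : ∀ i ≤ J, 4 / (κ * τ i) ≤ 4 * α ^ (ε / 2) := by
    intro i hi
    have h2 : α ^ (-(ε / 2)) ≤ κ * τ i := calc
      α ^ (-(ε / 2)) = α ^ (-(1 / 2 + ε / 2)) * α ^ (1 / 2 : ℝ) := by
        rw [← Real.rpow_add h0]; congr 1; ring
      _ ≤ κ * τ i := mul_le_mul hκ1 (hmono (hle i hi)) (hpos _).le hκ0'.le
    rw [Real.rpow_neg h0.le] at h2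
    rw [div_le_iff₀ (mul_pos hκ0' (hτ0 i)), mul_assoc]
    have h3 := (inv_le_iff_one_le_mul₀' (hpos (ε / 2))).1 h2
    linarith
  have hτJ : τ J ≤ α * κ / 8 := by
    calc τ J = α ^ (1 / 2 : ℝ) := by rw [hτdef]; beta_reduce; rw [heJ]
      _ ≤ α ^ (1 / 2 - ε / 4 : ℝ) := hmono (by linarith)
      _ = α * α ^ (-(1 / 2 + ε / 2)) * α ^ (ε / 4) := by
          nth_rewrite 2 [← Real.rpow_one α]
          rw [← Real.rpow_add h0, ← Real.rpow_add h0]; congr 1; ring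
      _ ≤ α * κ * (1 / 16) := by
          have := hpos (ε / 4)
          gcongr
      _ ≤ α * κ / 8 := by
          have : 0 ≤ α * κ := by positivity
          linarith
  set n := 2 ^ (κ * (2 * J + 3)) + 1 with hn
  have hn2 : 2 ≤ n := by
    have := Nat.one_le_two_pow (n := κ * (2 * J + 3))
    omega
  have hmain := h.measure_flux_lt_le h0.le hκ0 hτ0 J hτ hδ hτJ (n := n) (Nat.lt_succ_self _)
  have hτ00 : τ 0 = (α ^ (1 / 2 : ℝ))⁻¹ := by
    rw [hτdef]; beta_reduce; rw [he0, Real.rpow_neg h0.le]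
  have h4 : 4 / τ 0 = 4 * α ^ (1 / 2 : ℝ) := by rw [hτ00, div_inv_eq_mul]
  rw [h4] at hmain
  refine (measure_mono fun ω hω => ?_).trans hmain
  by_contra hno
  have hflux : C ≤ flux (fun k => U k ω) (fun k => A k ω) n := by
    have h5 : τ 0 / 2 ≤ (flux (fun k => U k ω) (fun k => A k ω) n : ℝ) + 1 := not_lt.1 hno
    have h6 : C + 1 ≤ τ 0 / 2 := by
      rw [hτ00, inv_eq_one_div, div_div, le_div_iff₀ (by have := hpos (1 / 2); positivity)]
      linarith
    linarith
  refine hω (logLog_div_lt hn2 (appearanceTime_le hflux) (abs_pos.2 (Real.log_neg h0 h1).ne) ?_)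
  rw [exp_mul_abs_log h0 h1]
  have hlog : Real.log n ≤ κ * (2 * J + 3) + 1 := by
    have h5 : (n : ℝ) ≤ 2 ^ (κ * (2 * J + 3) + 1) := by
      have := Nat.one_le_two_pow (n := κ * (2 * J + 3))
      have : n ≤ 2 ^ (κ * (2 * J + 3) + 1) := by rw [pow_succ]; omega
      exact_mod_cast this
    calc Real.log n ≤ Real.log (2 ^ (κ * (2 * J + 3) + 1)) :=
          Real.log_le_log (by positivity) h5
      _ = ((κ * (2 * J + 3) + 1 : ℕ) : ℝ) * Real.log 2 := Real.log_pow _ _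
      _ ≤ ((κ * (2 * J + 3) + 1 : ℕ) : ℝ) * 1 := by
          gcongr
          linarith [Real.log_two_lt_d9]
      _ = κ * (2 * J + 3) + 1 := by push_cast; ring
  have hκ3 : (1 : ℝ) ≤ κ := by exact_mod_cast hκ0
  calc Real.log n ≤ κ * (2 * J + 3) + 1 := hlog
    _ ≤ κ * (2 * J + 4) := by linarith
    _ ≤ 2 * α ^ (-(1 / 2 + ε / 2)) * (2 * J + 4) := by gcongr
    _ = (4 * J + 8) * α ^ (ε / 2) * α ^ (-(1 / 2 + ε)) := by
        have : -(1 / 2 + ε / 2) = ε / 2 + -(1 / 2 + ε) := by ring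
        rw [this, Real.rpow_add h0]
        ring
    _ < 1 * α ^ (-(1 / 2 + ε)) := by
        have := hpos (-(1 / 2 + ε))
        gcongr
    _ = _ := one_mul _

end Model

theorem mainTheorem4 {Ω : ℝ → Type*} [∀ α, MeasurableSpace (Ω α)]
    (P : ∀ α, Measure (Ω α)) [∀ α, IsProbabilityMeasure (P α)]
    (U : ∀ α : ℝ, (k : ℕ) → Ω α → Fin (k + 1)) (A : ∀ α : ℝ, ℕ → Ω α → ℕ)
    (hmodel : ∀ α ∈ Set.Ioc (0 : ℝ) 1, IsParkingOnRRT (P α) (U α) (A α) (binaryLaw α))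
    (C : ℝ) (hC : 0 < C) :
    TendstoInProbability P
      (fun α ω => logLog (appearanceTime (fun k => U α k ω) (fun k => A α k ω) C) /
        ((|Real.log α| : ℝ) : EReal))
      (𝓝[>] (0 : ℝ)) (1 / 2) := by
  intro ε hε
  obtain ⟨J, hJ⟩ := exists_nat_ge (4 / ε)
  have hhalf : Tendsto (fun α : ℝ => α ^ (1 / 2 : ℝ)) (𝓝[>] 0) (𝓝 0) :=
    tendsto_rpow_nhdsGT_zero (by norm_num)
  have hε2 : Tendsto (fun α : ℝ => α ^ (ε / 2)) (𝓝[>] 0) (𝓝 0) :=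
    tendsto_rpow_nhdsGT_zero (by positivity)
  have hid : Tendsto (fun α : ℝ => α) (𝓝[>] 0) (𝓝 0) := nhdsWithin_le_nhds
  have e1 : ∀ᶠ α : ℝ in 𝓝[>] 0, 3 / 2 * (α ^ (1 / 2 : ℝ) + α ^ ε) < 1 / 2 := by
    have := (hhalf.add (tendsto_rpow_nhdsGT_zero hε)).const_mul (3 / 2)
    exact this.eventually_lt_const (by norm_num)
  have e2 : ∀ᶠ α : ℝ in 𝓝[>] 0, α ^ (ε / 4) < 1 / 16 :=
    (tendsto_rpow_nhdsGT_zero (by positivity : 0 < ε / 4)).eventually_lt_const (by norm_num)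
  have e3 : ∀ᶠ α : ℝ in 𝓝[>] 0, (C + 1) * α ^ (1 / 2 : ℝ) < 1 / 2 :=
    (hhalf.const_mul (C + 1)).eventually_lt_const (by norm_num)
  have e4 : ∀ᶠ α : ℝ in 𝓝[>] 0, (4 * J + 8) * α ^ (ε / 2) < 1 :=
    (hε2.const_mul (4 * (J : ℝ) + 8)).eventually_lt_const (by norm_num)
  have e5 : ∀ᶠ α : ℝ in 𝓝[>] 0, α < 1 := hid.eventually_lt_const one_pos
  have hbound : Tendsto (fun α : ℝ => ENNReal.ofReal (3 * α) +
      ENNReal.ofReal ((J + 1) * (4 * α ^ (ε / 2)) + 4 * α ^ (1 / 2 : ℝ))) (𝓝[>] 0) (𝓝 0) := by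
    have h1 := ENNReal.tendsto_ofReal (hid.const_mul 3)
    have h2 := ENNReal.tendsto_ofReal
      (((hε2.const_mul 4).const_mul ((J : ℝ) + 1)).add (hhalf.const_mul 4))
    simpa using h1.add h2
  refine tendsto_of_tendsto_of_tendsto_of_le_of_le' tendsto_const_nhds hbound
    (Eventually.of_forall fun _ => zero_le) ?_
  filter_upwards [e1, e2, e3, e4, e5, self_mem_nhdsWithin] with α h1 h2 h3 h4 h5 h0
  have h0 : 0 < α := h0
  have h := hmodel α ⟨h0, h5.le⟩
  refine le_trans (measure_mono fun ω hω => ?_) ((measure_union_le _ _).trans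
    (add_le_add (h.measure_logLog_le_le (ε := ε) h0 h5 hC h1.le)
      (h.measure_le_logLog_le (C := C) h0 h5 hε hJ h2.le h3.le h4)))
  exact not_and_or.1 hω
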